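/- Let $q\in\mathbb{C}$ be nonzero and not a root of unity, and fix a square root $q^{1/2}$ of $q$ (the result holds for either choice). Write $[m]_q=\frac{q^m-q^{-m}}{q-q^{-1}}$ and $[X,Y]_q=qXY-q^{-1}YX$. **The centralizer.** $U_q(\mathfrak{sl}_2)$ is the associative unital $\mathbb{C}$-algebra generated by $E,F$ and $q^{H}$ (invertible, with inverse $q^{-H}$) with relations $q^HE=qEq^H$, $q^HF=q^{-1}Fq^H$, $[E,F]=\frac{q^{2H}-q^{-2H}}{q-q^{-1}}$. Its comultiplication is given by $\Delta(E)=E\otimes q^{-H}+q^H\otimes E$, $\Delta(F)=F\otimes q^{-H}+q^H\otimes F$, $\Delta(q^{H})=q^{H}\otimes q^{H}$; put $\Delta^{(2)}=(\mathrm{id}\otimes\Delta)\Delta$. Its Casimir element is $\Gamma=(q-q^{-1})^2FE+q\,q^{2H}+q^{-1}q^{-2H}$. Let $M_{1/2}=\mathbb{C}^2$ with basis $v_0,v_1$ be the spin-$\frac12$ representation $\pi$: $q^Hv_k=q^{1/2-k}v_k$, $Ev_0=0$, $Ev_1=v_0$, $Fv_0=v_1$, $Fv_1=0$. Let $\mathcal{C}_{\frac12,\frac12,\frac12}$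 be the algebra of all $m\in\mathrm{End}(M_{1/2}^{\otimes 3})$ commuting with $\pi^{\otimes3}(\Delta^{(2)}(x))$ for every $x\in U_q(\mathfrak{sl}_2)$, and put $$C_{12}=\pi^{\otimes3}(\Delta(\Gamma)\otimes1),\quad C_{23}=\pi^{\otimes3}(1\otimes\Delta(\Gamma)),\quad C_{123}=\pi^{\otimes3}(\Delta^{(2)}(\Gamma)).$$ **The quotient of the Askey–Wilson algebra.** $AW(3)$ is the associative unital $\mathbb{C}$-algebra generated by $A,B,D$ and central elements $\alpha_1,\alpha_2,\alpha_3,K$ with relations $$A+\tfrac{[B,D]_q}{q^2-q^{-2}}=\tfrac{\alpha_1\alpha_2+\alpha_3K}{q+q^{-1}},\quad B+\tfrac{[D,A]_q}{q^2-q^{-2}}=\tfrac{\alpha_2\alpha_3+\alpha_1K}{q+q^{-1}},\quad D+\tfrac{[A,B]_q}{q^2-q^{-2}}=\tfrac{\alpha_1\alpha_3+\alpha_2K}{q+q^{-1}}.$$ Let $D'=\frac{\alpha_1\alpha_3+\alpha_2K}{q+q^{-1}}-\frac{[B,A]_q}{q^2-q^{-2}}$ and $$\Omega=qA(\alpha_1\alpha_2+\alpha_3K)+q^{-1}B(\alpha_2\alpha_3+\alpha_1K)+qD(\alpha_1\alpha_3+\alpha_2K)-q^2A^2-q^{-2}B^2-q^2D^2-qABD.$$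 With $\chi_j=q^{2j+1}+q^{-2j-1}$ and $\mathcal{M}=\{\chi_{3/2}-\chi_1,\ \chi_{1/2}-\chi_1,\ \chi_{1/2}-\chi_0\}$, the algebra $\overline{AW}(\frac12,\frac12,\frac12)$ is the quotient of $AW(3)$ by the relations - $\alpha_1=\alpha_2=\alpha_3=\chi_{1/2}$; - $(X-\chi_0)(X-\chi_1)=0$ for $X=A,B,D,D'$, and $(K-\chi_{1/2})(K-\chi_{3/2})=0$; - $\prod_{m\in\mathcal{M}}(K-X-m)=0$ for $X=A,B,D,D'$; - $\Omega=3\chi_{1/2}^2+K^2+\chi_{1/2}^3K-(q+q^{-1})^2$. **Theorem.** There is a unique isomorphism of $\mathbb{C}$-algebras $\overline\phi:\overline{AW}(\tfrac12,\tfrac12,\tfrac12)\to\mathcal{C}_{\frac12,\frac12,\frac12}$ such that $$\overline\phi(A)=C_{12},\qquad \overline\phi(B)=C_{23},\qquad \overline\phi(K)=C_{123}.$$ -/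

import Mathlib

open scoped TensorProduct

/-! ## The quantum algebra `U_q(sl₂)` -/

/-- The `q`-number `[m]_q = (q^m - q^{-m}) / (q - q⁻¹)`. -/
noncomputable def qNum (q : ℂ) (m : ℤ) : ℂ := (q ^ m - q ^ (-m)) / (q - q⁻¹)

/-- Names of the generators `E`, `F`, `q^H`, `q^{-H}` of `U_q(sl₂)`. -/
inductive UqGen : Type
  | E | F | qH | qHinv

/-- The defining relations of `U_q(sl₂)`; `[2H]_q` stands for `(q^{2H} - q^{-2H}) / (q - q⁻¹)`. -/
inductive UqRel (q : ℂ) : FreeAlgebra ℂ UqGen → FreeAlgebra ℂ UqGen → Prop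
  | mul_inv : UqRel q (FreeAlgebra.ι ℂ .qH * FreeAlgebra.ι ℂ .qHinv) 1
  | inv_mul : UqRel q (FreeAlgebra.ι ℂ .qHinv * FreeAlgebra.ι ℂ .qH) 1
  | qH_E : UqRel q (FreeAlgebra.ι ℂ .qH * FreeAlgebra.ι ℂ .E)
      (q • (FreeAlgebra.ι ℂ .E * FreeAlgebra.ι ℂ .qH))
  | qH_F : UqRel q (FreeAlgebra.ι ℂ .qH * FreeAlgebra.ι ℂ .F)
      (q⁻¹ • (FreeAlgebra.ι ℂ .F * FreeAlgebra.ι ℂ .qH))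
  | E_F : UqRel q
      (FreeAlgebra.ι ℂ .E * FreeAlgebra.ι ℂ .F - FreeAlgebra.ι ℂ .F * FreeAlgebra.ι ℂ .E)
      ((q - q⁻¹)⁻¹ • (FreeAlgebra.ι ℂ .qH ^ 2 - FreeAlgebra.ι ℂ .qHinv ^ 2))

/-- The quantum algebra `U_q(sl₂)` over `ℂ`, by generators and relations. -/
def Uq (q : ℂ) : Type := RingQuot (UqRel q)

noncomputable instance (q : ℂ) : Ring (Uq q) :=
  inferInstanceAs (Ring (RingQuot (UqRel q)))

noncomputable instance (q : ℂ) : Algebra ℂ (Uq q) :=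
  inferInstanceAs (Algebra ℂ (RingQuot (UqRel q)))

/-- The quotient map onto `Uq`. -/
noncomputable def Uq.mk (q : ℂ) : FreeAlgebra ℂ UqGen →ₐ[ℂ] Uq q :=
  RingQuot.mkAlgHom ℂ (UqRel q)

namespace Uq

theorem mk_rel {q : ℂ} {x y : FreeAlgebra ℂ UqGen} (h : UqRel q x y) : mk q x = mk q y :=
  RingQuot.mkAlgHom_rel ℂ h

/-- The generators, as elements of `U_q(sl₂)`. -/
noncomputable def gen (q : ℂ) (x : UqGen) : Uq q :=
  mk q (FreeAlgebra.ι ℂ x)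

noncomputable def E (q : ℂ) : Uq q := gen q .E
noncomputable def F (q : ℂ) : Uq q := gen q .F
/-- The element `q^H`. -/
noncomputable def qH (q : ℂ) : Uq q := gen q .qH
/-- The element `q^{-H}`. -/
noncomputable def qHinv (q : ℂ) : Uq q := gen q .qHinv

theorem qH_mul_qHinv (q : ℂ) : qH q * qHinv q = 1 := by
  simpa [qH, qHinv, gen] using mk_rel (UqRel.mul_inv (q := q))

theorem qHinv_mul_qH (q : ℂ) : qHinv q * qH q = 1 := by
  simpa [qH, qHinv, gen] using mk_rel (UqRel.inv_mul (q := q))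

theorem qH_mul_E (q : ℂ) : qH q * E q = q • (E q * qH q) := by
  simpa [qH, E, gen] using mk_rel (UqRel.qH_E (q := q))

theorem qH_mul_F (q : ℂ) : qH q * F q = q⁻¹ • (F q * qH q) := by
  simpa [qH, F, gen] using mk_rel (UqRel.qH_F (q := q))

theorem E_mul_F_sub (q : ℂ) :
    E q * F q - F q * E q = (q - q⁻¹)⁻¹ • (qH q ^ 2 - qHinv q ^ 2) := by
  simpa [qH, qHinv, E, F, gen] using mk_rel (UqRel.E_F (q := q))

theorem qHinv_mul_E {q : ℂ} (hq : q ≠ 0) : qHinv q * E q = q⁻¹ • (E q * qHinv q) := by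
  have h : E q * qHinv q = q • (qHinv q * E q) := by
    calc E q * qHinv q = qHinv q * (qH q * E q) * qHinv q := by
          rw [← mul_assoc, qHinv_mul_qH, one_mul]
      _ = q • (qHinv q * E q) := by
          rw [qH_mul_E, mul_smul_comm, smul_mul_assoc, mul_assoc, mul_assoc, qH_mul_qHinv, mul_one]
  rw [h, smul_smul, inv_mul_cancel₀ hq, one_smul]

theorem F_mul_qHinv (q : ℂ) : F q * qHinv q = q⁻¹ • (qHinv q * F q) := by
  calc F q * qHinv q = qHinv q * (qH q * F q) * qHinv q := by
        rw [← mul_assoc, qHinv_mul_qH, one_mul]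
    _ = q⁻¹ • (qHinv q * F q) := by
        rw [qH_mul_F, mul_smul_comm, smul_mul_assoc, mul_assoc, mul_assoc, qH_mul_qHinv, mul_one]

/-- The algebra homomorphism out of `U_q(sl₂)` determined by images of the generators
that satisfy the defining relations. -/
noncomputable def lift {q : ℂ} {R : Type*} [Ring R] [Algebra ℂ R] (e f k k' : R)
    (h₁ : k * k' = 1) (h₂ : k' * k = 1) (h₃ : k * e = q • (e * k)) (h₄ : k * f = q⁻¹ • (f * k))
    (h₅ : e * f - f * e = (q - q⁻¹)⁻¹ • (k ^ 2 - k' ^ 2)) : Uq q →ₐ[ℂ] R :=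
  RingQuot.liftAlgHom ℂ
    ⟨FreeAlgebra.lift ℂ (fun x => match x with
      | UqGen.E => e
      | UqGen.F => f
      | UqGen.qH => k
      | UqGen.qHinv => k'), by
      intro x y h
      cases h <;> simp [h₁, h₂, h₃, h₄, h₅]⟩

/-- The quadratic Casimir element `(q - q⁻¹)² F E + q q^{2H} + q⁻¹ q^{-2H}`. -/
noncomputable def casimir (q : ℂ) : Uq q :=
  (q - q⁻¹) ^ 2 • (F q * E q) + q • qH q ^ 2 + q⁻¹ • qHinv q ^ 2

/-- The comultiplication `Δ`: `Δ(E) = E ⊗ q^{-H} + q^H ⊗ E`, `Δ(F) = F ⊗ q^{-H} + q^H ⊗ F`,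
`Δ(q^{±H}) = q^{±H} ⊗ q^{±H}`. -/
noncomputable def comul {q : ℂ} (hq : q ≠ 0) : Uq q →ₐ[ℂ] Uq q ⊗[ℂ] Uq q :=
  lift (q := q) (E q ⊗ₜ qHinv q + qH q ⊗ₜ E q) (F q ⊗ₜ qHinv q + qH q ⊗ₜ F q)
    (qH q ⊗ₜ qH q) (qHinv q ⊗ₜ qHinv q)
    (by simp [qH_mul_qHinv, Algebra.TensorProduct.one_def])
    (by simp [qHinv_mul_qH, Algebra.TensorProduct.one_def])
    (by
      simp [mul_add, add_mul, qH_mul_E, qH_mul_qHinv, qHinv_mul_qH, TensorProduct.smul_tmul'])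
    (by
      simp [mul_add, add_mul, qH_mul_F, qH_mul_qHinv, qHinv_mul_qH, TensorProduct.smul_tmul'])
    (by
      have hEF : E q * F q = F q * E q + (q - q⁻¹)⁻¹ • (qH q ^ 2 - qHinv q ^ 2) := by
        rw [← E_mul_F_sub]; abel
      simp only [mul_add, add_mul, Algebra.TensorProduct.tmul_mul_tmul, hEF, qH_mul_E, qH_mul_F,
        F_mul_qHinv, qHinv_mul_E hq, Algebra.TensorProduct.tmul_pow, TensorProduct.add_tmul,
        TensorProduct.tmul_add, TensorProduct.smul_tmul', TensorProduct.tmul_smul,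
        TensorProduct.sub_tmul, TensorProduct.tmul_sub, smul_smul, smul_sub, ← pow_two,
        inv_mul_cancel₀ hq, one_smul]
      abel)

/-- `Δ⁽²⁾ = (id ⊗ Δ) ∘ Δ`, with values in `U ⊗ (U ⊗ U)`. -/
noncomputable def comul₂ {q : ℂ} (hq : q ≠ 0) :
    Uq q →ₐ[ℂ] Uq q ⊗[ℂ] (Uq q ⊗[ℂ] Uq q) :=
  (Algebra.TensorProduct.map (AlgHom.id ℂ (Uq q)) (comul hq)).comp (comul hq)

/-- `Γ₁₂ = Δ(Γ) ⊗ 1`. -/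
noncomputable def casimir₁₂ {q : ℂ} (hq : q ≠ 0) : Uq q ⊗[ℂ] (Uq q ⊗[ℂ] Uq q) :=
  Algebra.TensorProduct.assoc ℂ ℂ ℂ (Uq q) (Uq q) (Uq q) (comul hq (casimir q) ⊗ₜ 1)

/-- `Γ₂₃ = 1 ⊗ Δ(Γ)`. -/
noncomputable def casimir₂₃ {q : ℂ} (hq : q ≠ 0) : Uq q ⊗[ℂ] (Uq q ⊗[ℂ] Uq q) :=
  1 ⊗ₜ comul hq (casimir q)

/-- `Γ₁₂₃ = Δ⁽²⁾(Γ)`. -/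
noncomputable def casimir₁₂₃ {q : ℂ} (hq : q ≠ 0) : Uq q ⊗[ℂ] (Uq q ⊗[ℂ] Uq q) :=
  comul₂ hq (casimir q)

end Uq

/-! ## Finite irreducible representations

Spins are encoded by `n = 2j : ℕ`. On the weight vectors `v_0, …, v_n` of the spin-`n/2`
representation, `q^H v_k = q^{n/2 - k} v_k`, `E v_k = [k]_q [n - k + 1]_q v_{k-1}` and
`F v_k = v_{k+1}`. As `q^H` has the eigenvalues `q^{n/2 - k}`, a square root `r` of `q` is fixed. -/

/-- The underlying space `M_{n/2}` of the spin-`n/2` representation, of dimension `n + 1`. -/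
abbrev SpinSpace (n : ℕ) : Type := Fin (n + 1) → ℂ

/-- The matrix of `E` in the spin-`n/2` representation. -/
noncomputable def spinE (q : ℂ) (n : ℕ) : Matrix (Fin (n + 1)) (Fin (n + 1)) ℂ :=
  Matrix.of fun i k => if (i : ℕ) + 1 = k then qNum q (k : ℤ) * qNum q ((n : ℤ) - k + 1) else 0

/-- The matrix of `F` in the spin-`n/2` representation. -/
def spinF (n : ℕ) : Matrix (Fin (n + 1)) (Fin (n + 1)) ℂ :=
  Matrix.of fun i k => if (i : ℕ) = k + 1 then 1 else 0

/-- The matrix of `q^H` in the spin-`n/2` representation, with `r` the square root of `q`. -/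
noncomputable def spinQH (r : ℂ) (n : ℕ) : Matrix (Fin (n + 1)) (Fin (n + 1)) ℂ :=
  Matrix.diagonal fun k => r ^ ((n : ℤ) - 2 * k)

/-- The matrix of `q^{-H}` in the spin-`n/2` representation. -/
noncomputable def spinQHinv (r : ℂ) (n : ℕ) : Matrix (Fin (n + 1)) (Fin (n + 1)) ℂ :=
  Matrix.diagonal fun k => r ^ (-((n : ℤ) - 2 * k))

theorem sq_root_ne_zero {q r : ℂ} (hq : q ≠ 0) (hr : r ^ 2 = q) : r ≠ 0 := by
  rintro rfl
  exact hq (by simpa using hr.symm)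

theorem qNum_mul_sub {q : ℂ} (hq : q ≠ 0) (n k : ℤ) :
    qNum q (k + 1) * qNum q (n - k) - qNum q k * qNum q (n - k + 1) = qNum q (n - 2 * k) := by
  unfold qNum
  by_cases hd : q - q⁻¹ = 0
  · simp [hd]
  have ha : q ^ k ≠ 0 := zpow_ne_zero _ hq
  have hb : q ^ n ≠ 0 := zpow_ne_zero _ hq
  have hd' : q ^ 2 - 1 ≠ 0 := by
    intro h
    apply hd
    field_simp
    linear_combination h
  have e : q ^ (n - 2 * k) = q ^ n / (q ^ k * q ^ k) := by
    rw [two_mul, zpow_sub₀ hq, zpow_add₀ hq]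
  simp only [zpow_neg, e, zpow_sub₀ hq, zpow_add₀ hq, zpow_one]
  field_simp
  ring

theorem spinE_mul_spinF (q : ℂ) (n : ℕ) : spinE q n * spinF n
    = Matrix.diagonal fun k : Fin (n + 1) => qNum q ((k : ℕ) + 1) * qNum q ((n : ℤ) - (k : ℕ)) := by
  ext i k
  rw [Matrix.mul_apply, Matrix.diagonal_apply]
  simp only [spinE, spinF, Matrix.of_apply, mul_ite, mul_one, mul_zero]
  split_ifs with h
  · subst h
    by_cases hi : (i : ℕ) < n
    · rw [Finset.sum_eq_single (⟨i + 1, by omega⟩ : Fin (n + 1))]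
      · have e : (n : ℤ) - ((i : ℕ) + 1) + 1 = (n : ℤ) - (i : ℕ) := by ring
        simp [e]
      · intro m _ hm
        rw [if_neg]
        intro hm'
        exact hm (Fin.ext hm')
      · simp
    · have hn : (n : ℤ) - (i : ℕ) = 0 := by omega
      rw [hn, Finset.sum_eq_zero]
      · simp [qNum]
      · intro m _
        rw [if_neg]
        omega
  · apply Finset.sum_eq_zero
    intro m _
    split_ifs with h₁ h₂
    · exact absurd (Fin.ext (by omega)) h
    · rfl
    · rfl

theorem spinF_mul_spinE (q : ℂ) (n : ℕ) : spinF n * spinE q n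
    = Matrix.diagonal fun k : Fin (n + 1) => qNum q (k : ℕ) * qNum q ((n : ℤ) - (k : ℕ) + 1) := by
  ext i k
  rw [Matrix.mul_apply, Matrix.diagonal_apply]
  simp only [spinE, spinF, Matrix.of_apply, ite_mul, one_mul, zero_mul]
  split_ifs with h
  · subst h
    by_cases hi : 0 < (i : ℕ)
    · rw [Finset.sum_eq_single (⟨i - 1, by omega⟩ : Fin (n + 1))]
      · rw [if_pos, if_pos] <;> simp only [] <;> omega
      · intro m _ hm
        rw [if_neg]
        intro hm'
        exact hm (Fin.ext (by simp only []; omega))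
      · simp
    · have hn : (i : ℕ) = 0 := by omega
      rw [hn, Finset.sum_eq_zero]
      · simp [qNum]
      · intro m _
        rw [if_neg]
        omega
  · apply Finset.sum_eq_zero
    intro m _
    split_ifs with h₁ h₂
    · exact absurd (Fin.ext (by omega)) h
    · rfl
    · rfl

theorem spinE_mul_spinF_sub {q r : ℂ} (hq : q ≠ 0) (hr : r ^ 2 = q) (n : ℕ) :
    spinE q n * spinF n - spinF n * spinE q n
      = (q - q⁻¹)⁻¹ • (spinQH r n ^ 2 - spinQHinv r n ^ 2) := by
  have hz : ∀ m : ℤ, (r ^ m) ^ 2 = q ^ m := by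
    intro m
    rw [← hr, ← zpow_natCast, ← zpow_natCast, ← zpow_mul, ← zpow_mul, mul_comm]
  rw [spinE_mul_spinF, spinF_mul_spinE, Matrix.diagonal_sub, spinQH, spinQHinv,
    Matrix.diagonal_pow, Matrix.diagonal_pow, Matrix.diagonal_sub, ← Matrix.diagonal_smul]
  congr 1
  funext k
  rw [qNum_mul_sub hq]
  simp only [qNum, Pi.smul_apply, Pi.pow_apply, smul_eq_mul, hz]
  rw [div_eq_inv_mul]

/-- The representation map `π_j : U_q(sl₂) → End(M_j)`, `j = n/2`. -/
noncomputable def spinRep {q r : ℂ} (hq : q ≠ 0) (hr : r ^ 2 = q) (n : ℕ) :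
    Uq q →ₐ[ℂ] Module.End ℂ (SpinSpace n) :=
  (Matrix.toLinAlgEquiv' : Matrix (Fin (n + 1)) (Fin (n + 1)) ℂ ≃ₐ[ℂ] _).toAlgHom.comp
    (Uq.lift (q := q) (spinE q n) (spinF n) (spinQH r n) (spinQHinv r n)
      (by
        have h0 := sq_root_ne_zero hq hr
        simp [spinQH, spinQHinv, ← zpow_add₀ h0])
      (by
        have h0 := sq_root_ne_zero hq hr
        simp [spinQH, spinQHinv, ← zpow_add₀ h0])
      (by
        have h0 := sq_root_ne_zero hq hr
        ext i k
        simp only [spinQH, spinE, Matrix.diagonal_mul, Matrix.mul_diagonal, Matrix.smul_apply,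
          Matrix.of_apply, smul_eq_mul]
        split_ifs with h
        · have e : (n : ℤ) - 2 * (i : ℕ) = 2 + ((n : ℤ) - 2 * (k : ℕ)) := by omega
          rw [e, zpow_add₀ h0, ← hr]
          norm_cast
          ring
        · simp)
      (by
        have h0 := sq_root_ne_zero hq hr
        ext i k
        simp only [spinQH, spinF, Matrix.diagonal_mul, Matrix.mul_diagonal, Matrix.smul_apply,
          Matrix.of_apply, smul_eq_mul]
        split_ifs with h
        · have e : (n : ℤ) - 2 * (i : ℕ) = -2 + ((n : ℤ) - 2 * (k : ℕ)) := by omega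
          rw [e, zpow_add₀ h0, ← hr, zpow_neg]
          norm_cast
          ring
        · simp)
      (spinE_mul_spinF_sub hq hr n))

/-- `End(M_{j₁} ⊗ M_{j₂} ⊗ M_{j₃})`, `j_i = n_i/2`. -/
abbrev End₃ (n₁ n₂ n₃ : ℕ) : Type :=
  Module.End ℂ (SpinSpace n₁ ⊗[ℂ] (SpinSpace n₂ ⊗[ℂ] SpinSpace n₃))

/-- The map `π_{j₁,j₂,j₃} = π_{j₁} ⊗ π_{j₂} ⊗ π_{j₃}` from `U ⊗ (U ⊗ U)` to
`End(M_{j₁} ⊗ M_{j₂} ⊗ M_{j₃})`. -/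
noncomputable def spinRep₃ {q r : ℂ} (hq : q ≠ 0) (hr : r ^ 2 = q) (n₁ n₂ n₃ : ℕ) :
    Uq q ⊗[ℂ] (Uq q ⊗[ℂ] Uq q) →ₐ[ℂ] End₃ n₁ n₂ n₃ :=
  Module.endTensorEndAlgHom.comp
    (Algebra.TensorProduct.map (spinRep hq hr n₁)
      (Module.endTensorEndAlgHom.comp
        (Algebra.TensorProduct.map (spinRep hq hr n₂) (spinRep hq hr n₃))))

/-- The centralizer `C_{j₁,j₂,j₃}` of the diagonal embedding of `U_q(sl₂)` in
`End(M_{j₁} ⊗ M_{j₂} ⊗ M_{j₃})`. -/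
noncomputable def spinCentralizer {q r : ℂ} (hq : q ≠ 0) (hr : r ^ 2 = q) (n₁ n₂ n₃ : ℕ) :
    Subalgebra ℂ (End₃ n₁ n₂ n₃) :=
  Subalgebra.centralizer ℂ (Set.range fun x : Uq q => spinRep₃ hq hr n₁ n₂ n₃ (Uq.comul₂ hq x))

/-! ## The Askey–Wilson algebra and its quotient -/

/-- Names of the generators of the centrally extended Askey–Wilson algebra `AW(3)`. -/
inductive AWGen : Type
  | A | B | D | α₁ | α₂ | α₃ | K

/-- The generators of `AW(3)` that are required to be central. -/
def AWGen.IsCentral : AWGen → Prop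
  | .A | .B | .D => False
  | .α₁ | .α₂ | .α₃ | .K => True

/-- The `q`-commutator `[x, y]_q = q x y - q⁻¹ y x`. -/
noncomputable def qComm {R : Type*} [Ring R] [Algebra ℂ R] (q : ℂ) (x y : R) : R :=
  q • (x * y) - q⁻¹ • (y * x)

/-- The defining relations of `AW(3)`. -/
inductive AWRel (q : ℂ) : FreeAlgebra ℂ AWGen → FreeAlgebra ℂ AWGen → Prop
  | central (c x : AWGen) (hc : c.IsCentral) :
      AWRel q (FreeAlgebra.ι ℂ c * FreeAlgebra.ι ℂ x) (FreeAlgebra.ι ℂ x * FreeAlgebra.ι ℂ c)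
  | BD : AWRel q
      (FreeAlgebra.ι ℂ .A
        + (q ^ 2 - (q ^ 2)⁻¹)⁻¹ • qComm q (FreeAlgebra.ι ℂ .B) (FreeAlgebra.ι ℂ .D))
      ((q + q⁻¹)⁻¹ • (FreeAlgebra.ι ℂ .α₁ * FreeAlgebra.ι ℂ .α₂
        + FreeAlgebra.ι ℂ .α₃ * FreeAlgebra.ι ℂ .K))
  | DA : AWRel q
      (FreeAlgebra.ι ℂ .B
        + (q ^ 2 - (q ^ 2)⁻¹)⁻¹ • qComm q (FreeAlgebra.ι ℂ .D) (FreeAlgebra.ι ℂ .A))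
      ((q + q⁻¹)⁻¹ • (FreeAlgebra.ι ℂ .α₂ * FreeAlgebra.ι ℂ .α₃
        + FreeAlgebra.ι ℂ .α₁ * FreeAlgebra.ι ℂ .K))
  | AB : AWRel q
      (FreeAlgebra.ι ℂ .D
        + (q ^ 2 - (q ^ 2)⁻¹)⁻¹ • qComm q (FreeAlgebra.ι ℂ .A) (FreeAlgebra.ι ℂ .B))
      ((q + q⁻¹)⁻¹ • (FreeAlgebra.ι ℂ .α₁ * FreeAlgebra.ι ℂ .α₃
        + FreeAlgebra.ι ℂ .α₂ * FreeAlgebra.ι ℂ .K))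

/-- The centrally extended Askey–Wilson algebra `AW(3)`. -/
def AW3 (q : ℂ) : Type := RingQuot (AWRel q)

noncomputable instance (q : ℂ) : Ring (AW3 q) :=
  inferInstanceAs (Ring (RingQuot (AWRel q)))

noncomputable instance (q : ℂ) : Algebra ℂ (AW3 q) :=
  inferInstanceAs (Algebra ℂ (RingQuot (AWRel q)))

/-- The quotient map onto `AW3`. -/
noncomputable def AW3.mk (q : ℂ) : FreeAlgebra ℂ AWGen →ₐ[ℂ] AW3 q :=
  RingQuot.mkAlgHom ℂ (AWRel q)

namespace AW3

/-- The generators, as elements of `AW(3)`. -/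
noncomputable def gen (q : ℂ) (x : AWGen) : AW3 q :=
  mk q (FreeAlgebra.ι ℂ x)

noncomputable def A (q : ℂ) : AW3 q := gen q .A
noncomputable def B (q : ℂ) : AW3 q := gen q .B
noncomputable def D (q : ℂ) : AW3 q := gen q .D
noncomputable def α₁ (q : ℂ) : AW3 q := gen q .α₁
noncomputable def α₂ (q : ℂ) : AW3 q := gen q .α₂
noncomputable def α₃ (q : ℂ) : AW3 q := gen q .α₃
noncomputable def K (q : ℂ) : AW3 q := gen q .K

/-- The element `D'`, determined by
`D' + [B, A]_q / (q² - q⁻²) = (α₁ α₃ + α₂ K) / (q + q⁻¹)`. -/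
noncomputable def D' (q : ℂ) : AW3 q :=
  (q + q⁻¹)⁻¹ • (α₁ q * α₃ q + α₂ q * K q) - (q ^ 2 - (q ^ 2)⁻¹)⁻¹ • qComm q (B q) (A q)

/-- The Casimir element `Ω` of `AW(3)`. -/
noncomputable def Ω (q : ℂ) : AW3 q :=
  q • (A q * (α₁ q * α₂ q + α₃ q * K q)) + q⁻¹ • (B q * (α₂ q * α₃ q + α₁ q * K q))
    + q • (D q * (α₁ q * α₃ q + α₂ q * K q))
    - q ^ 2 • A q ^ 2 - (q ^ 2)⁻¹ • B q ^ 2 - q ^ 2 • D q ^ 2 - q • (A q * B q * D q)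

end AW3

/-- `χ_j = q^{2j+1} + q^{-2j-1}` for `j = n/2`. -/
noncomputable def chi (q : ℂ) (n : ℕ) : ℂ := q ^ (n + 1) + (q ^ (n + 1))⁻¹

/-- The set `J(j₁, j₂) = {|j₁ - j₂|, |j₁ - j₂| + 1, …, j₁ + j₂}`, in doubled spins. -/
def spinJ (n₁ n₂ : ℕ) : Finset ℕ :=
  (Finset.range (min n₁ n₂ + 1)).image fun k => (max n₁ n₂ - min n₁ n₂) + 2 * k

/-- The set `J(j₁, j₂, j₃) = ⋃_{j ∈ J(j₁, j₂)} J(j, j₃)`, in doubled spins. -/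
def spinJ₃ (n₁ n₂ n₃ : ℕ) : Finset ℕ := (spinJ n₁ n₂).biUnion fun j => spinJ j n₃

/-- The set `M(j_a, j_b, j_c) = ⋃_{j ∈ J(j_a, j_b)} {χ_ℓ - χ_j | ℓ ∈ J(j, j_c)}`. -/
noncomputable def spinM (q : ℂ) (na nb nc : ℕ) : Finset ℂ :=
  (spinJ na nb).biUnion fun j => (spinJ j nc).image fun l => chi q l - chi q j

/-- `∏_{c ∈ S} (x - c)`. -/
noncomputable def rootProd {R : Type*} [Ring R] [Algebra ℂ R] (S : Finset ℂ) (x : R) : R :=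
  Polynomial.aeval x (∏ c ∈ S, (Polynomial.X - Polynomial.C c))

/-- `∏_{j ∈ J} (x - χ_j)`. -/
noncomputable def chiProd {R : Type*} [Ring R] [Algebra ℂ R] (q : ℂ) (J : Finset ℕ) (x : R) : R :=
  Polynomial.aeval x (∏ j ∈ J, (Polynomial.X - Polynomial.C (chi q j)))

open AW3 in
/-- The relations imposed on `AW(3)` to define its quotient attached to the spins
`j_i = n_i/2`. -/
inductive AWBarRel (q : ℂ) (n₁ n₂ n₃ : ℕ) : AW3 q → AW3 q → Prop
  | α₁ : AWBarRel q n₁ n₂ n₃ (α₁ q) (algebraMap ℂ (AW3 q) (chi q n₁))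
  | α₂ : AWBarRel q n₁ n₂ n₃ (α₂ q) (algebraMap ℂ (AW3 q) (chi q n₂))
  | α₃ : AWBarRel q n₁ n₂ n₃ (α₃ q) (algebraMap ℂ (AW3 q) (chi q n₃))
  | A : AWBarRel q n₁ n₂ n₃ (chiProd q (spinJ n₁ n₂) (A q)) 0
  | B : AWBarRel q n₁ n₂ n₃ (chiProd q (spinJ n₂ n₃) (B q)) 0
  | K : AWBarRel q n₁ n₂ n₃ (chiProd q (spinJ₃ n₁ n₂ n₃) (K q)) 0
  | D : AWBarRel q n₁ n₂ n₃ (chiProd q (spinJ n₁ n₃) (D q)) 0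
  | D' : AWBarRel q n₁ n₂ n₃ (chiProd q (spinJ n₁ n₃) (D' q)) 0
  | K_sub_A : AWBarRel q n₁ n₂ n₃ (rootProd (spinM q n₁ n₂ n₃) (K q - A q)) 0
  | K_sub_B : AWBarRel q n₁ n₂ n₃ (rootProd (spinM q n₂ n₃ n₁) (K q - B q)) 0
  | K_sub_D : AWBarRel q n₁ n₂ n₃ (rootProd (spinM q n₁ n₃ n₂) (K q - D q)) 0
  | K_sub_D' : AWBarRel q n₁ n₂ n₃ (rootProd (spinM q n₁ n₃ n₂) (K q - D' q)) 0
  | Ω : AWBarRel q n₁ n₂ n₃ (Ω q)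
      (algebraMap ℂ (AW3 q) (chi q n₁ ^ 2 + chi q n₂ ^ 2 + chi q n₃ ^ 2) + K q ^ 2
        + (chi q n₁ * chi q n₂ * chi q n₃) • K q - algebraMap ℂ (AW3 q) ((q + q⁻¹) ^ 2))

/-- The quotient of the Askey–Wilson algebra `AW(3)` attached to the spins `j_i = n_i/2`. -/
def AWBar (q : ℂ) (n₁ n₂ n₃ : ℕ) : Type := RingQuot (AWBarRel q n₁ n₂ n₃)

noncomputable instance (q : ℂ) (n₁ n₂ n₃ : ℕ) : Ring (AWBar q n₁ n₂ n₃) :=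
  inferInstanceAs (Ring (RingQuot (AWBarRel q n₁ n₂ n₃)))

noncomputable instance (q : ℂ) (n₁ n₂ n₃ : ℕ) : Algebra ℂ (AWBar q n₁ n₂ n₃) :=
  inferInstanceAs (Algebra ℂ (RingQuot (AWBarRel q n₁ n₂ n₃)))

/-- The quotient map onto `AWBar`. -/
noncomputable def AWBar.mk (q : ℂ) (n₁ n₂ n₃ : ℕ) : AW3 q →ₐ[ℂ] AWBar q n₁ n₂ n₃ :=
  RingQuot.mkAlgHom ℂ (AWBarRel q n₁ n₂ n₃)

/-- The relations of the Temperley–Lieb algebra on three strands, with loop value `q + q⁻¹`. -/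
structure IsTL {R : Type*} [Ring R] [Algebra ℂ R] (q : ℂ) (e f : R) : Prop where
  ee : e * e = (q + q⁻¹) • e
  ff : f * f = (q + q⁻¹) • f
  efe : e * (f * e) = e
  fef : f * (e * f) = f

/-- Linear combinations of the words `1, e, f, ef, fe`. -/
def tlWord {R : Type*} [Ring R] [Algebra ℂ R] (e f : R) (a b c d g : ℂ) : R :=
  a • 1 + b • e + c • f + d • (e * f) + g • (f * e)

section TL

variable {R : Type*} [Ring R] [Algebra ℂ R] {q : ℂ} {e f : R}

theorem tlWord_add (a b c d g a' b' c' d' g' : ℂ) :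
    tlWord e f a b c d g + tlWord e f a' b' c' d' g' =
      tlWord e f (a + a') (b + b') (c + c') (d + d') (g + g') := by
  unfold tlWord
  module

theorem tlWord_sub (a b c d g a' b' c' d' g' : ℂ) :
    tlWord e f a b c d g - tlWord e f a' b' c' d' g' =
      tlWord e f (a - a') (b - b') (c - c') (d - d') (g - g') := by
  unfold tlWord
  module

theorem tlWord_smul (k a b c d g : ℂ) :
    k • tlWord e f a b c d g = tlWord e f (k * a) (k * b) (k * c) (k * d) (k * g) := by
  unfold tlWord
  module

theorem algebraMap_eq_tlWord (k : ℂ) : algebraMap ℂ R k = tlWord e f k 0 0 0 0 := by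
  simp [tlWord, Algebra.algebraMap_eq_smul_one]

theorem map_tlWord {S : Type*} [Ring S] [Algebra ℂ S] (φ : R →ₐ[ℂ] S) (a b c d g : ℂ) :
    φ (tlWord e f a b c d g) = tlWord (φ e) (φ f) a b c d g := by
  simp [tlWord]

theorem commute_tlWord {R : Type*} [Ring R] [Algebra ℂ R] {e f x : R} (he : Commute e x)
    (hf : Commute f x) (a b c d g : ℂ) : Commute (tlWord e f a b c d g) x :=
  (((((Commute.one_left x).smul_left a).add_left (he.smul_left b)).add_left
    (hf.smul_left c)).add_left ((he.mul_left hf).smul_left d)).add_left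
    ((hf.mul_left he).smul_left g)

theorem IsTL.tlWord_mul (h : IsTL q e f) (a b c d g a' b' c' d' g' : ℂ) :
    tlWord e f a b c d g * tlWord e f a' b' c' d' g' =
      tlWord e f (a * a')
        (a * b' + b * a' + (q + q⁻¹) * (b * b') + b * g' + d * b' + (q + q⁻¹) * (d * g'))
        (a * c' + c * a' + (q + q⁻¹) * (c * c') + c * d' + g * c' + (q + q⁻¹) * (g * d'))
        (a * d' + d * a' + b * c' + (q + q⁻¹) * (b * d') + (q + q⁻¹) * (d * c') + d * d')
        (a * g' + g * a' + c * b' + (q + q⁻¹) * (c * g') + (q + q⁻¹) * (g * b') + g * g') := by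
  have ee' (y : R) : e * (e * y) = (q + q⁻¹) • (e * y) := by
    rw [← mul_assoc, h.ee, smul_mul_assoc]
  have ff' (y : R) : f * (f * y) = (q + q⁻¹) • (f * y) := by
    rw [← mul_assoc, h.ff, smul_mul_assoc]
  simp only [tlWord, mul_add, add_mul, smul_mul_assoc, mul_smul_comm, one_mul, mul_one, mul_assoc,
    h.ee, h.ff, h.efe, h.fef, ee', ff']
  module

/-- The image of the Askey–Wilson generator with parameters `(b, c, d, g)`. -/
noncomputable def tlAW (q : ℂ) (e f : R) (b c d g : ℂ) : R :=
  tlWord e f (chi q 2) (-(q - q⁻¹) ^ 2 * b) (-(q - q⁻¹) ^ 2 * c) (-(q - q⁻¹) ^ 2 * d)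
    (-(q - q⁻¹) ^ 2 * g)

/-- The image of the central generator `K`. -/
noncomputable def tlK (q : ℂ) (e f : R) : R :=
  tlWord e f (chi q 3) (-(q - q⁻¹) ^ 2 * (q + q⁻¹)) (-(q - q⁻¹) ^ 2 * (q + q⁻¹))
    ((q - q⁻¹) ^ 2) ((q - q⁻¹) ^ 2)

theorem IsTL.tlK_mul (h : IsTL q e f) (a b c d g : ℂ) :
    tlK q e f * tlWord e f a b c d g = tlWord e f a b c d g * tlK q e f := by
  simp only [tlK, h.tlWord_mul]
  congr 1 <;> ring

section

variable (hq : q ≠ 0) (h : IsTL q e f)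
include hq h

theorem IsTL.relBD (h2 : q + q⁻¹ ≠ 0) (h4 : q ^ 2 - (q ^ 2)⁻¹ ≠ 0) :
    tlAW q e f 1 0 0 0 + (q ^ 2 - (q ^ 2)⁻¹)⁻¹ •
        qComm q (tlAW q e f 0 1 0 0) (tlAW q e f 1 1 (-q⁻¹) (-q)) =
      (q + q⁻¹)⁻¹ • (algebraMap ℂ R (chi q 1) * algebraMap ℂ R (chi q 1) +
        algebraMap ℂ R (chi q 1) * tlK q e f) := by
  have h2' : q ^ 2 + 1 ≠ 0 := by
    intro h'; apply h2; field_simp; linear_combination h'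
  have h4' : q ^ 4 - 1 ≠ 0 := by
    intro h'; apply h4; field_simp; linear_combination h'
  simp only [tlAW, tlK, qComm, algebraMap_eq_tlWord (e := e) (f := f), h.tlWord_mul, tlWord_add,
    tlWord_sub, tlWord_smul, chi]
  congr 1 <;> field_simp <;> ring

theorem IsTL.relDA (h2 : q + q⁻¹ ≠ 0) (h4 : q ^ 2 - (q ^ 2)⁻¹ ≠ 0) :
    tlAW q e f 0 1 0 0 + (q ^ 2 - (q ^ 2)⁻¹)⁻¹ •
        qComm q (tlAW q e f 1 1 (-q⁻¹) (-q)) (tlAW q e f 1 0 0 0) =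
      (q + q⁻¹)⁻¹ • (algebraMap ℂ R (chi q 1) * algebraMap ℂ R (chi q 1) +
        algebraMap ℂ R (chi q 1) * tlK q e f) := by
  have h2' : q ^ 2 + 1 ≠ 0 := by
    intro h'; apply h2; field_simp; linear_combination h'
  have h4' : q ^ 4 - 1 ≠ 0 := by
    intro h'; apply h4; field_simp; linear_combination h'
  simp only [tlAW, tlK, qComm, algebraMap_eq_tlWord (e := e) (f := f), h.tlWord_mul, tlWord_add,
    tlWord_sub, tlWord_smul, chi]
  congr 1 <;> field_simp <;> ring

theorem IsTL.relAB (h2 : q + q⁻¹ ≠ 0) (h4 : q ^ 2 - (q ^ 2)⁻¹ ≠ 0) :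
    tlAW q e f 1 1 (-q⁻¹) (-q) + (q ^ 2 - (q ^ 2)⁻¹)⁻¹ •
        qComm q (tlAW q e f 1 0 0 0) (tlAW q e f 0 1 0 0) =
      (q + q⁻¹)⁻¹ • (algebraMap ℂ R (chi q 1) * algebraMap ℂ R (chi q 1) +
        algebraMap ℂ R (chi q 1) * tlK q e f) := by
  have h2' : q ^ 2 + 1 ≠ 0 := by
    intro h'; apply h2; field_simp; linear_combination h'
  have h4' : q ^ 4 - 1 ≠ 0 := by
    intro h'; apply h4; field_simp; linear_combination h'
  simp only [tlAW, tlK, qComm, algebraMap_eq_tlWord (e := e) (f := f), h.tlWord_mul, tlWord_add,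
    tlWord_sub, tlWord_smul, chi]
  congr 1 <;> field_simp <;> ring

theorem IsTL.relBA (h2 : q + q⁻¹ ≠ 0) (h4 : q ^ 2 - (q ^ 2)⁻¹ ≠ 0) :
    (q + q⁻¹)⁻¹ • (algebraMap ℂ R (chi q 1) * algebraMap ℂ R (chi q 1) +
        algebraMap ℂ R (chi q 1) * tlK q e f) - (q ^ 2 - (q ^ 2)⁻¹)⁻¹ •
        qComm q (tlAW q e f 0 1 0 0) (tlAW q e f 1 0 0 0) =
      tlAW q e f 1 1 (-q) (-q⁻¹) := by
  have h2' : q ^ 2 + 1 ≠ 0 := by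
    intro h'; apply h2; field_simp; linear_combination h'
  have h4' : q ^ 4 - 1 ≠ 0 := by
    intro h'; apply h4; field_simp; linear_combination h'
  simp only [tlAW, tlK, qComm, algebraMap_eq_tlWord (e := e) (f := f), h.tlWord_mul, tlWord_add,
    tlWord_sub, tlWord_smul, chi]
  congr 1 <;> field_simp <;> ring

set_option maxHeartbeats 4000000 in
theorem IsTL.relΩ :
    q • (tlAW q e f 1 0 0 0 * (algebraMap ℂ R (chi q 1) * algebraMap ℂ R (chi q 1) +
        algebraMap ℂ R (chi q 1) * tlK q e f))
      + q⁻¹ • (tlAW q e f 0 1 0 0 * (algebraMap ℂ R (chi q 1) * algebraMap ℂ R (chi q 1) +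
        algebraMap ℂ R (chi q 1) * tlK q e f))
      + q • (tlAW q e f 1 1 (-q⁻¹) (-q) * (algebraMap ℂ R (chi q 1) * algebraMap ℂ R (chi q 1) +
        algebraMap ℂ R (chi q 1) * tlK q e f))
      - q ^ 2 • tlAW q e f 1 0 0 0 ^ 2 - (q ^ 2)⁻¹ • tlAW q e f 0 1 0 0 ^ 2
      - q ^ 2 • tlAW q e f 1 1 (-q⁻¹) (-q) ^ 2
      - q • (tlAW q e f 1 0 0 0 * tlAW q e f 0 1 0 0 * tlAW q e f 1 1 (-q⁻¹) (-q)) =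
    algebraMap ℂ R (chi q 1 ^ 2 + chi q 1 ^ 2 + chi q 1 ^ 2) + tlK q e f ^ 2
        + (chi q 1 * chi q 1 * chi q 1) • tlK q e f - algebraMap ℂ R ((q + q⁻¹) ^ 2) := by
  simp only [tlAW, tlK, algebraMap_eq_tlWord (e := e) (f := f), h.tlWord_mul, tlWord_add,
    tlWord_sub, tlWord_smul, chi, pow_two (tlWord _ _ _ _ _ _ _)]
  congr 1 <;> field_simp <;> ring

theorem IsTL.chi_relK :
    (tlK q e f - algebraMap ℂ R (chi q 1)) * (tlK q e f - algebraMap ℂ R (chi q 3)) = 0 := by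
  rw [← map_zero (algebraMap ℂ R)]
  simp only [tlK, algebraMap_eq_tlWord (e := e) (f := f), h.tlWord_mul, tlWord_sub, chi]
  congr 1 <;> field_simp <;> ring

end

/-- The parameters `(b, c, d, g)` for which `b e + c f + d ef + g fe` is `q + q⁻¹` times an
idempotent annihilated by the Jones–Wenzl element. -/
structure IsTLGenerator (q b c d g : ℂ) : Prop where
  he : (q + q⁻¹) * (b * b) + b * g + d * b + (q + q⁻¹) * (d * g) = (q + q⁻¹) * b
  hf : (q + q⁻¹) * (c * c) + c * d + g * c + (q + q⁻¹) * (g * d) = (q + q⁻¹) * c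
  hef : b * c + (q + q⁻¹) * (b * d) + (q + q⁻¹) * (d * c) + d * d = (q + q⁻¹) * d
  hfe : c * b + (q + q⁻¹) * (c * g) + (q + q⁻¹) * (g * b) + g * g = (q + q⁻¹) * g

theorem IsTL.tlWord_generator_sq (h : IsTL q e f) {b c d g : ℂ} (hx : IsTLGenerator q b c d g) :
    tlWord e f 0 b c d g * tlWord e f 0 b c d g = (q + q⁻¹) • tlWord e f 0 b c d g := by
  rw [h.tlWord_mul, tlWord_smul]
  congr 1
  · ring
  · linear_combination hx.he
  · linear_combination hx.hf
  · linear_combination hx.hef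
  · linear_combination hx.hfe

/-- The multiple `[3]_q - [2]_q (e + f) + ef + fe` of the Jones–Wenzl idempotent. -/
noncomputable def jonesWenzl (q : ℂ) (e f : R) : R :=
  tlWord e f ((q + q⁻¹) ^ 2 - 1) (-(q + q⁻¹)) (-(q + q⁻¹)) 1 1

theorem IsTL.jonesWenzl_mul (h : IsTL q e f) (a b c d g : ℂ) :
    jonesWenzl q e f * tlWord e f a b c d g = a • jonesWenzl q e f := by
  simp only [jonesWenzl, h.tlWord_mul, tlWord_smul]
  congr 1 <;> ring

theorem IsTL.mul_jonesWenzl (h : IsTL q e f) (a b c d g : ℂ) :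
    tlWord e f a b c d g * jonesWenzl q e f = a • jonesWenzl q e f := by
  simp only [jonesWenzl, h.tlWord_mul, tlWord_smul]
  congr 1 <;> ring

theorem tlK_eq (hq : q ≠ 0) :
    tlK q e f = chi q 1 • 1 + (q - q⁻¹) ^ 2 • jonesWenzl q e f := by
  have hχ : chi q 3 = chi q 1 + (q - q⁻¹) ^ 2 * ((q + q⁻¹) ^ 2 - 1) := by
    simp only [chi]; field_simp; ring
  simp only [tlK, hχ, jonesWenzl, tlWord]
  module

theorem tlAW_eq (b c d g : ℂ) :
    tlAW q e f b c d g = chi q 2 • 1 - (q - q⁻¹) ^ 2 • tlWord e f 0 b c d g := by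
  simp only [tlAW, tlWord]
  module

section

variable (hq : q ≠ 0) (h : IsTL q e f) {b c d g : ℂ} (hx : IsTLGenerator q b c d g)
include hq h hx

theorem IsTL.chi_rel :
    (tlAW q e f b c d g - algebraMap ℂ R (chi q 0)) *
      (tlAW q e f b c d g - algebraMap ℂ R (chi q 2)) = 0 := by
  have hχ : chi q 2 - chi q 0 = (q - q⁻¹) ^ 2 * (q + q⁻¹) := by
    simp only [chi]; field_simp; ring
  rw [← map_zero (algebraMap ℂ R)]
  simp only [tlAW, algebraMap_eq_tlWord (e := e) (f := f), h.tlWord_mul, tlWord_sub, hχ]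
  congr 1
  · ring
  · linear_combination (q - q⁻¹) ^ 4 * hx.he
  · linear_combination (q - q⁻¹) ^ 4 * hx.hf
  · linear_combination (q - q⁻¹) ^ 4 * hx.hef
  · linear_combination (q - q⁻¹) ^ 4 * hx.hfe

theorem IsTL.root_rel :
    (tlK q e f - tlAW q e f b c d g - algebraMap ℂ R (chi q 1 - chi q 0)) *
      ((tlK q e f - tlAW q e f b c d g - algebraMap ℂ R (chi q 1 - chi q 2)) *
      (tlK q e f - tlAW q e f b c d g - algebraMap ℂ R (chi q 3 - chi q 2))) = 0 := by
  have h0 : chi q 0 = chi q 2 - (q - q⁻¹) ^ 2 * (q + q⁻¹) := by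
    simp only [chi]; field_simp; ring
  have h3 : chi q 3 = chi q 1 + (q - q⁻¹) ^ 2 * ((q + q⁻¹) ^ 2 - 1) := by
    simp only [chi]; field_simp; ring
  have hJG := h.jonesWenzl_mul 0 b c d g
  have hGJ := h.mul_jonesWenzl 0 b c d g
  have hGG := h.tlWord_generator_sq hx
  have hJJ : jonesWenzl q e f * jonesWenzl q e f = ((q + q⁻¹) ^ 2 - 1) • jonesWenzl q e f := by
    conv_lhs => rw [jonesWenzl, ← jonesWenzl, jonesWenzl, h.tlWord_mul]
    simp only [jonesWenzl, tlWord_smul]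
    congr 1 <;> ring
  rw [tlK_eq hq, tlAW_eq, h0, h3]
  generalize jonesWenzl q e f = J at *
  generalize tlWord e f 0 b c d g = G at *
  rw [zero_smul] at hJG hGJ
  have key : (chi q 1 • 1 + (q - q⁻¹) ^ 2 • J - (chi q 2 • 1 - (q - q⁻¹) ^ 2 • G) -
        algebraMap ℂ R (chi q 1 - chi q 2)) *
      (chi q 1 • 1 + (q - q⁻¹) ^ 2 • J - (chi q 2 • 1 - (q - q⁻¹) ^ 2 • G) -
        algebraMap ℂ R (chi q 1 + (q - q⁻¹) ^ 2 * ((q + q⁻¹) ^ 2 - 1) - chi q 2)) =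
      ((q - q⁻¹) ^ 4 * (q + q⁻¹ - ((q + q⁻¹) ^ 2 - 1))) • G := by
    simp only [Algebra.algebraMap_eq_smul_one, add_mul, mul_add, sub_mul, mul_sub, smul_mul_assoc,
      mul_smul_comm, one_mul, mul_one, hJG, hGJ, hGG, hJJ]
    module
  rw [key]
  simp only [Algebra.algebraMap_eq_smul_one, add_mul, sub_mul, smul_mul_assoc,
    mul_smul_comm, one_mul, hJG, hGG]
  module

end
end TL

section Presentation

variable {R : Type*} [Ring R] [Algebra ℂ R] {q : ℂ} {e f p : R}

/-- The Askey–Wilson generator `D` in terms of `e`, `f` and the central idempotent `p`. -/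
noncomputable def awD (q : ℂ) (e f p : R) : R :=
  (q + q⁻¹)⁻¹ • ((chi q 1 * chi q 1) • 1 + chi q 1 • (chi q 1 • 1 + (chi q 3 - chi q 1) • p)) -
    (q ^ 2 - (q ^ 2)⁻¹)⁻¹ • qComm q (chi q 2 • 1 - (q - q⁻¹) ^ 2 • e)
      (chi q 2 • 1 - (q - q⁻¹) ^ 2 • f)

/-- The defect in the identification of the central idempotent `p` with a multiple of the
Jones–Wenzl element. -/
noncomputable def jwDefect (q : ℂ) (e f p : R) : R :=
  jonesWenzl q e f - ((q + q⁻¹) ^ 2 - 1) • p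

variable (hq : q ≠ 0) (h4 : q ^ 4 ≠ 1)
  (hee : e * e = (q + q⁻¹) • e) (hff : f * f = (q + q⁻¹) • f)
  (hep : e * p = 0) (hpe : p * e = 0) (hfp : f * p = 0) (hpf : p * f = 0)

include hq h4 hff hfp hpf in
theorem relBD_sub :
    (chi q 2 • 1 - (q - q⁻¹) ^ 2 • e) + (q ^ 2 - (q ^ 2)⁻¹)⁻¹ •
        qComm q (chi q 2 • 1 - (q - q⁻¹) ^ 2 • f) (awD q e f p) -
      (q + q⁻¹)⁻¹ • ((chi q 1 * chi q 1) • 1 +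
        chi q 1 • (chi q 1 • 1 + (chi q 3 - chi q 1) • p)) =
    ((q - q⁻¹) ^ 4 * chi q 1 / (q + q⁻¹) ^ 2) •
      (f * (e * f) - f - (q + q⁻¹) • jwDefect q e f p) := by
  have h4' : q ^ 4 - 1 ≠ 0 := sub_ne_zero.2 h4
  have h2 : q ^ 2 + 1 ≠ 0 := by
    intro h; apply h4'; linear_combination (q ^ 2 - 1) * h
  have ff' (y : R) : f * (f * y) = (q + q⁻¹) • (f * y) := by
    rw [← mul_assoc, hff, smul_mul_assoc]
  simp only [awD, jwDefect, jonesWenzl, tlWord, qComm, mul_add, add_mul, mul_sub, sub_mul, smul_add,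
    smul_sub, smul_mul_assoc, mul_smul_comm, one_mul, mul_one, mul_assoc, hff, ff', hfp, hpf,
    smul_zero]
  simp only [chi]
  match_scalars <;> field_simp <;> ring

include hq h4 hee hep hpe in
theorem relDA_sub :
    (chi q 2 • 1 - (q - q⁻¹) ^ 2 • f) + (q ^ 2 - (q ^ 2)⁻¹)⁻¹ •
        qComm q (awD q e f p) (chi q 2 • 1 - (q - q⁻¹) ^ 2 • e) -
      (q + q⁻¹)⁻¹ • ((chi q 1 * chi q 1) • 1 +
        chi q 1 • (chi q 1 • 1 + (chi q 3 - chi q 1) • p)) =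
    ((q - q⁻¹) ^ 4 * chi q 1 / (q + q⁻¹) ^ 2) •
      (e * (f * e) - e - (q + q⁻¹) • jwDefect q e f p) := by
  have h4' : q ^ 4 - 1 ≠ 0 := sub_ne_zero.2 h4
  have h2 : q ^ 2 + 1 ≠ 0 := by
    intro h; apply h4'; linear_combination (q ^ 2 - 1) * h
  have ee' (y : R) : e * (e * y) = (q + q⁻¹) • (e * y) := by
    rw [← mul_assoc, hee, smul_mul_assoc]
  simp only [awD, jwDefect, jonesWenzl, tlWord, qComm, mul_add, add_mul, mul_sub, sub_mul, smul_add,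
    smul_sub, smul_mul_assoc, mul_smul_comm, one_mul, mul_one, mul_assoc, hee, ee', hep, hpe,
    smul_zero]
  simp only [chi]
  match_scalars <;> field_simp <;> ring

include hee hep in
theorem mul_jwDefect_left : e * jwDefect q e f p = e * (f * e) - e := by
  have ee' (y : R) : e * (e * y) = (q + q⁻¹) • (e * y) := by
    rw [← mul_assoc, hee, smul_mul_assoc]
  simp only [jwDefect, jonesWenzl, tlWord, mul_add, mul_sub, mul_smul_comm, mul_one, hee, ee', hep]
  module

include hff hfp in
theorem mul_jwDefect_right : f * jwDefect q e f p = f * (e * f) - f := by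
  have ff' (y : R) : f * (f * y) = (q + q⁻¹) • (f * y) := by
    rw [← mul_assoc, hff, smul_mul_assoc]
  simp only [jwDefect, jonesWenzl, tlWord, mul_add, mul_sub, mul_smul_comm, mul_one, hff, ff', hfp]
  module

include hpe hpf in
theorem idempotent_mul_jwDefect (hpp : p * p = p) : p * jwDefect q e f p = 0 := by
  simp only [jwDefect, jonesWenzl, tlWord, mul_add, mul_sub, mul_smul_comm, mul_one, ← mul_assoc,
    hpe, hpf, zero_mul, hpp]
  module

include hq h4 hee hff hep hpe hfp hpf in
/-- If `e`, `f`, `p` give rise to the Askey–Wilson relations, then `e`, `f` satisfy the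
Temperley–Lieb relations and `p` is a multiple of the Jones–Wenzl element. -/
theorem isTL_of_awRel (h6 : q ^ 6 ≠ 1) (h8 : q ^ 8 ≠ 1) (hpp : p * p = p)
    (hBD : (chi q 2 • 1 - (q - q⁻¹) ^ 2 • e) + (q ^ 2 - (q ^ 2)⁻¹)⁻¹ •
        qComm q (chi q 2 • 1 - (q - q⁻¹) ^ 2 • f) (awD q e f p) =
      (q + q⁻¹)⁻¹ • ((chi q 1 * chi q 1) • 1 +
        chi q 1 • (chi q 1 • 1 + (chi q 3 - chi q 1) • p)))
    (hDA : (chi q 2 • 1 - (q - q⁻¹) ^ 2 • f) + (q ^ 2 - (q ^ 2)⁻¹)⁻¹ •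
        qComm q (awD q e f p) (chi q 2 • 1 - (q - q⁻¹) ^ 2 • e) =
      (q + q⁻¹)⁻¹ • ((chi q 1 * chi q 1) • 1 +
        chi q 1 • (chi q 1 • 1 + (chi q 3 - chi q 1) • p)))
    (hD : (awD q e f p - chi q 0 • 1) * (awD q e f p - chi q 2 • 1) = 0) :
    IsTL q e f ∧ jonesWenzl q e f = ((q + q⁻¹) ^ 2 - 1) • p := by
  have h4' : q ^ 4 - 1 ≠ 0 := sub_ne_zero.2 h4
  have h2 : q ^ 2 + 1 ≠ 0 := by
    intro h; apply h4'; linear_combination (q ^ 2 - 1) * h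
  have h2' : q ^ 2 - 1 ≠ 0 := by
    intro h; apply h4'; linear_combination (q ^ 2 + 1) * h
  have h3 : q ^ 4 + q ^ 2 + 1 ≠ 0 := by
    intro h; apply h6; linear_combination (q ^ 2 - 1) * h
  have h5 : q ^ 4 + 1 ≠ 0 := by
    intro h; apply h8; linear_combination (q ^ 4 - 1) * h
  have hc : (q - q⁻¹) ^ 4 * chi q 1 / (q + q⁻¹) ^ 2 ≠ 0 := by
    have : (q - q⁻¹) ^ 4 * chi q 1 / (q + q⁻¹) ^ 2 =
        (q ^ 2 - 1) ^ 4 * (q ^ 4 + 1) / (q ^ 4 * (q ^ 2 + 1) ^ 2) := by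
      simp only [chi]; field_simp; ring
    rw [this]
    positivity
  have hfef : f * (e * f) - f = (q + q⁻¹) • jwDefect q e f p := by
    have := relBD_sub (e := e) hq h4 hff hfp hpf
    rw [hBD, sub_self, eq_comm, smul_eq_zero_iff_right hc] at this
    exact sub_eq_zero.1 this
  have hefe : e * (f * e) - e = (q + q⁻¹) • jwDefect q e f p := by
    have := relDA_sub (f := f) hq h4 hee hep hpe
    rw [hDA, sub_self, eq_comm, smul_eq_zero_iff_right hc] at this
    exact sub_eq_zero.1 this
  have heJ := mul_jwDefect_left (f := f) hee hep
  have hfJ := mul_jwDefect_right (e := e) hff hfp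
  have hpJ := idempotent_mul_jwDefect (q := q) hpe hpf hpp
  rw [hefe] at heJ
  rw [hfef] at hfJ
  have hDJ : awD q e f p * jwDefect q e f p =
      ((2 * (q + q⁻¹) ^ 4 - 9 * (q + q⁻¹) ^ 2 + 8) / (q + q⁻¹)) • jwDefect q e f p := by
    generalize jwDefect q e f p = J at *
    simp only [awD, qComm, add_mul, mul_sub, sub_mul, smul_add,
      smul_sub, smul_mul_assoc, mul_smul_comm, one_mul, mul_one, mul_assoc, heJ, hfJ, hpJ,
      smul_zero]
    simp only [chi]
    match_scalars
    field_simp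
    ring
  have hJ : jwDefect q e f p = 0 := by
    have hx (x : ℂ) : (awD q e f p - x • 1) * jwDefect q e f p =
        ((2 * (q + q⁻¹) ^ 4 - 9 * (q + q⁻¹) ^ 2 + 8) / (q + q⁻¹) - x) • jwDefect q e f p := by
      rw [sub_mul, hDJ, smul_mul_assoc, one_mul, sub_smul]
    have h := congrArg (· * jwDefect q e f p) hD
    simp only [zero_mul, mul_assoc, hx, mul_smul_comm, smul_smul] at h
    refine (smul_eq_zero_iff_right (mul_ne_zero ?_ ?_)).1 h
    · have : (2 * (q + q⁻¹) ^ 4 - 9 * (q + q⁻¹) ^ 2 + 8) / (q + q⁻¹) - chi q 2 =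
          (q ^ 4 + 1) * (q ^ 2 - 1) ^ 2 / (q ^ 3 * (q ^ 2 + 1)) := by
        simp only [chi]; field_simp; ring
      rw [this]
      positivity
    · have : (2 * (q + q⁻¹) ^ 4 - 9 * (q + q⁻¹) ^ 2 + 8) / (q + q⁻¹) - chi q 0 =
          2 * (q ^ 4 + q ^ 2 + 1) * (q ^ 2 - 1) ^ 2 / (q ^ 3 * (q ^ 2 + 1)) := by
        simp only [chi]; field_simp; ring
      rw [this]
      exact div_ne_zero (mul_ne_zero (mul_ne_zero two_ne_zero h3) (pow_ne_zero _ h2'))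
        (mul_ne_zero (pow_ne_zero _ hq) h2)
  refine ⟨⟨hee, hff, ?_, ?_⟩, sub_eq_zero.1 hJ⟩
  · rw [hJ, smul_zero] at hefe
    exact sub_eq_zero.1 hefe
  · rw [hJ, smul_zero] at hfef
    exact sub_eq_zero.1 hfef

end Presentation

section Coefficients

variable {q : ℂ}

theorem chi_zero_ne_chi_two (hq : q ≠ 0) (h4 : q ^ 4 ≠ 1) : chi q 0 ≠ chi q 2 := by
  intro h
  have h4' : q ^ 4 - 1 ≠ 0 := sub_ne_zero.2 h4
  have h2' : q ^ 2 - 1 ≠ 0 := by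
    intro h; apply h4'; linear_combination (q ^ 2 + 1) * h
  have key : chi q 0 - chi q 2 = -((q ^ 4 - 1) * (q ^ 2 - 1) / q ^ 3) := by
    simp only [chi]; field_simp; ring
  rw [h, sub_self, eq_comm] at key
  exact neg_ne_zero.2 (div_ne_zero (mul_ne_zero h4' h2') (pow_ne_zero _ hq)) key

theorem chi_one_ne_chi_three (hq : q ≠ 0) (h6 : q ^ 6 ≠ 1) : chi q 1 ≠ chi q 3 := by
  intro h
  have h6' : q ^ 6 - 1 ≠ 0 := sub_ne_zero.2 h6
  have h2' : q ^ 2 - 1 ≠ 0 := by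
    intro h; apply h6'; linear_combination (q ^ 4 + q ^ 2 + 1) * h
  have key : chi q 1 - chi q 3 = -((q ^ 6 - 1) * (q ^ 2 - 1) / q ^ 4) := by
    simp only [chi]; field_simp; ring
  rw [h, sub_self, eq_comm] at key
  exact neg_ne_zero.2 (div_ne_zero (mul_ne_zero h6' h2') (pow_ne_zero _ hq)) key

theorem chi_one_sub_chi_zero_ne (hq : q ≠ 0) (h10 : q ^ 10 ≠ 1) :
    chi q 1 - chi q 0 ≠ chi q 3 - chi q 2 := by
  intro h
  have h5 : q ^ 5 + 1 ≠ 0 := by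
    intro h; apply h10; linear_combination (q ^ 5 - 1) * h
  have h1 : q - 1 ≠ 0 := by
    intro h; apply h10; rw [sub_eq_zero.1 h, one_pow]
  have h2 : q ^ 2 - 1 ≠ 0 := by
    intro h; apply h10; linear_combination (q ^ 8 + q ^ 6 + q ^ 4 + q ^ 2 + 1) * h
  have key : chi q 1 - chi q 0 - (chi q 3 - chi q 2) = -((q ^ 5 + 1) * (q - 1) * (q ^ 2 - 1) / q ^ 4) := by
    simp only [chi]; field_simp; ring
  rw [h, sub_self, eq_comm] at key
  exact neg_ne_zero.2
    (div_ne_zero (mul_ne_zero (mul_ne_zero h5 h1) h2) (pow_ne_zero _ hq)) key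

theorem chi_three_sub_chi_zero_ne (hq : q ≠ 0) (h5 : q ^ 5 ≠ 1) (h2 : q ^ 2 ≠ 1) :
    chi q 3 - chi q 0 ≠ chi q 1 - chi q 2 := by
  intro h
  have h5' : q ^ 5 - 1 ≠ 0 := sub_ne_zero.2 h5
  have h2' : q ^ 2 - 1 ≠ 0 := sub_ne_zero.2 h2
  have h1 : q + 1 ≠ 0 := by
    intro h; apply h2; linear_combination (q - 1) * h
  have key : chi q 3 - chi q 0 - (chi q 1 - chi q 2) = (q ^ 5 - 1) * (q + 1) * (q ^ 2 - 1) / q ^ 4 := by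
    simp only [chi]; field_simp; ring
  rw [h, sub_self, eq_comm] at key
  exact div_ne_zero (mul_ne_zero (mul_ne_zero h5' h1) h2') (pow_ne_zero _ hq) key

variable {R : Type*} [Ring R] [Algebra ℂ R]

theorem chiProd_spinJ_one_one (x : R) :
    chiProd q (spinJ 1 1) x = (x - algebraMap ℂ R (chi q 0)) * (x - algebraMap ℂ R (chi q 2)) := by
  have : spinJ 1 1 = {0, 2} := by decide
  simp [chiProd, this]

theorem chiProd_spinJ₃_one_one_one (x : R) :
    chiProd q (spinJ₃ 1 1 1) x =
      (x - algebraMap ℂ R (chi q 1)) * (x - algebraMap ℂ R (chi q 3)) := by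
  have : spinJ₃ 1 1 1 = {1, 3} := by decide
  simp [chiProd, this]

theorem rootProd_spinM_one_one_one (hq : q ≠ 0) (hroot : ∀ n : ℕ, 0 < n → q ^ n ≠ 1) (x : R) :
    rootProd (spinM q 1 1 1) x =
      (x - algebraMap ℂ R (chi q 1 - chi q 0)) * ((x - algebraMap ℂ R (chi q 1 - chi q 2)) *
        (x - algebraMap ℂ R (chi q 3 - chi q 2))) := by
  have hJ : spinJ 1 1 = {0, 2} := by decide
  have hJ' : spinJ 0 1 = {1} := by decide
  have hJ'' : spinJ 2 1 = {1, 3} := by decide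
  have hM : spinM q 1 1 1 = {chi q 1 - chi q 0, chi q 1 - chi q 2, chi q 3 - chi q 2} := by
    simp only [spinM, hJ, Finset.biUnion_insert, Finset.singleton_biUnion, hJ', hJ'',
      Finset.image_singleton, Finset.image_insert]
    rfl
  have h1 : chi q 1 - chi q 0 ∉ ({chi q 1 - chi q 2, chi q 3 - chi q 2} : Finset ℂ) := by
    simp only [Finset.mem_insert, Finset.mem_singleton, not_or]
    exact ⟨fun h => chi_zero_ne_chi_two hq (hroot 4 (by norm_num)) (sub_right_injective h),
      chi_one_sub_chi_zero_ne hq (hroot 10 (by norm_num))⟩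
  have h2 : chi q 1 - chi q 2 ∉ ({chi q 3 - chi q 2} : Finset ℂ) := by
    simp only [Finset.mem_singleton]
    exact fun h => chi_one_ne_chi_three hq (hroot 6 (by norm_num)) (sub_left_injective h)
  rw [rootProd, hM, Finset.prod_insert h1, Finset.prod_insert h2, Finset.prod_singleton]
  simp

/-- In the eigenspace of `K` for `χ_{3/2}`, a generator takes the value `χ_1`. -/
theorem mul_sub_chi_two_eq_zero (hq : q ≠ 0) (hroot : ∀ n : ℕ, 0 < n → q ^ n ≠ 1) {K X : R}
    (hKX : Commute K X)
    (hK : (K - algebraMap ℂ R (chi q 1)) * (K - algebraMap ℂ R (chi q 3)) = 0)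
    (hX : (X - algebraMap ℂ R (chi q 0)) * (X - algebraMap ℂ R (chi q 2)) = 0)
    (hroots : (K - X - algebraMap ℂ R (chi q 1 - chi q 0)) *
      ((K - X - algebraMap ℂ R (chi q 1 - chi q 2)) *
        (K - X - algebraMap ℂ R (chi q 3 - chi q 2))) = 0) :
    (K - algebraMap ℂ R (chi q 1)) * (X - algebraMap ℂ R (chi q 2)) = 0 := by
  have h02 := sub_ne_zero.2 (chi_zero_ne_chi_two hq (hroot 4 (by norm_num)))
  have h13 := sub_ne_zero.2 (chi_one_ne_chi_three hq (hroot 6 (by norm_num)))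
  have h30 := sub_ne_zero.2 (chi_three_sub_chi_zero_ne hq (hroot 5 (by norm_num))
    (hroot 2 (by norm_num)))
  generalize chi q 0 = x0 at *
  generalize chi q 1 = x1 at *
  generalize chi q 2 = x2 at *
  generalize chi q 3 = x3 at *
  have hXK : X * K = K * X := hKX.symm
  have hXX : X * X = (x0 + x2) • X - (x0 * x2) • 1 := by
    simp only [Algebra.algebraMap_eq_smul_one, sub_mul, mul_sub, smul_mul_assoc, mul_smul_comm,
      one_mul, mul_one] at hX
    rw [← sub_eq_zero, ← hX]
    module
  have hKK : K * K = (x1 + x3) • K - (x1 * x3) • 1 := by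
    simp only [Algebra.algebraMap_eq_smul_one, sub_mul, mul_sub, smul_mul_assoc, mul_smul_comm,
      one_mul, mul_one] at hK
    rw [← sub_eq_zero, ← hK]
    module
  have hKK' (y : R) : K * (K * y) = (x1 + x3) • (K * y) - (x1 * x3) • y := by
    rw [← mul_assoc, hKK, sub_mul, smul_mul_assoc, smul_mul_assoc, one_mul]
  have hXK' (y : R) : X * (K * y) = K * (X * y) := by
    rw [← mul_assoc, hXK, mul_assoc]
  have key : (K - algebraMap ℂ R x1) * ((K - X - algebraMap ℂ R (x1 - x0)) *
      ((K - X - algebraMap ℂ R (x1 - x2)) * (K - X - algebraMap ℂ R (x3 - x2)))) =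
      ((x3 - x0 - (x1 - x2)) * (x1 - x3)) • ((K - algebraMap ℂ R x1) * (X - algebraMap ℂ R x2)) := by
    simp only [Algebra.algebraMap_eq_smul_one, sub_mul, mul_sub, smul_mul_assoc, mul_smul_comm,
      one_mul, mul_one, hXK, hXK', hXX, hKK, hKK', smul_sub]
    module
  rw [hroots, mul_zero, eq_comm] at key
  exact (smul_eq_zero_iff_right (mul_ne_zero h30 h13)).1 key

end Coefficients

theorem AW3.mk_rel {q : ℂ} {x y : FreeAlgebra ℂ AWGen} (h : AWRel q x y) : mk q x = mk q y :=
  RingQuot.mkAlgHom_rel ℂ h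

theorem AWBar.mk_rel {q : ℂ} {n₁ n₂ n₃ : ℕ} {x y : AW3 q} (h : AWBarRel q n₁ n₂ n₃ x y) :
    mk q n₁ n₂ n₃ x = mk q n₁ n₂ n₃ y :=
  RingQuot.mkAlgHom_rel ℂ h

theorem AW3.mk_surjective (q : ℂ) : Function.Surjective (mk q) :=
  RingQuot.mkAlgHom_surjective ℂ (AWRel q)

theorem AWBar.mk_surjective (q : ℂ) (n₁ n₂ n₃ : ℕ) : Function.Surjective (mk q n₁ n₂ n₃) :=
  RingQuot.mkAlgHom_surjective ℂ (AWBarRel q n₁ n₂ n₃)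

theorem map_qComm {R S : Type*} [Ring R] [Algebra ℂ R] [Ring S] [Algebra ℂ S] (φ : R →ₐ[ℂ] S)
    (q : ℂ) (x y : R) : φ (qComm q x y) = qComm q (φ x) (φ y) := by
  simp [qComm]

theorem map_rootProd {R S : Type*} [Ring R] [Algebra ℂ R] [Ring S] [Algebra ℂ S] (φ : R →ₐ[ℂ] S)
    (T : Finset ℂ) (x : R) : φ (rootProd T x) = rootProd T (φ x) :=
  (Polynomial.aeval_algHom_apply φ x _).symm

theorem map_chiProd {R S : Type*} [Ring R] [Algebra ℂ R] [Ring S] [Algebra ℂ S] (φ : R →ₐ[ℂ] S)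
    (q : ℂ) (J : Finset ℕ) (x : R) : φ (chiProd q J x) = chiProd q J (φ x) :=
  (Polynomial.aeval_algHom_apply φ x _).symm

namespace AW3

variable (q : ℂ)

theorem central_mul {c x : AWGen} (hc : c.IsCentral) : gen q c * gen q x = gen q x * gen q c := by
  simpa [gen] using mk_rel (AWRel.central (q := q) c x hc)

theorem rel_BD : A q + (q ^ 2 - (q ^ 2)⁻¹)⁻¹ • qComm q (B q) (D q) =
    (q + q⁻¹)⁻¹ • (α₁ q * α₂ q + α₃ q * K q) := by
  simpa [map_qComm, A, B, D, α₁, α₂, α₃, K, gen] using mk_rel (AWRel.BD (q := q))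

theorem rel_DA : B q + (q ^ 2 - (q ^ 2)⁻¹)⁻¹ • qComm q (D q) (A q) =
    (q + q⁻¹)⁻¹ • (α₂ q * α₃ q + α₁ q * K q) := by
  simpa [map_qComm, A, B, D, α₁, α₂, α₃, K, gen] using mk_rel (AWRel.DA (q := q))

theorem rel_AB : D q + (q ^ 2 - (q ^ 2)⁻¹)⁻¹ • qComm q (A q) (B q) =
    (q + q⁻¹)⁻¹ • (α₁ q * α₃ q + α₂ q * K q) := by
  simpa [map_qComm, A, B, D, α₁, α₂, α₃, K, gen] using mk_rel (AWRel.AB (q := q))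

end AW3

namespace AWBar

variable (q : ℂ)

/-- The first Temperley–Lieb generator in the quotient of the Askey–Wilson algebra. -/
noncomputable def e : AWBar q 1 1 1 :=
  ((q - q⁻¹) ^ 2)⁻¹ • (chi q 2 • 1 - mk q 1 1 1 (AW3.A q))

/-- The second Temperley–Lieb generator in the quotient of the Askey–Wilson algebra. -/
noncomputable def f : AWBar q 1 1 1 :=
  ((q - q⁻¹) ^ 2)⁻¹ • (chi q 2 • 1 - mk q 1 1 1 (AW3.B q))

variable {q}

theorem sub_inv_ne_zero (hq : q ≠ 0) (h2 : q ^ 2 ≠ 1) : q - q⁻¹ ≠ 0 := by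
  intro h
  apply h2
  field_simp at h
  linear_combination h

theorem mk_A_eq (hq : q ≠ 0) (h2 : q ^ 2 ≠ 1) :
    mk q 1 1 1 (AW3.A q) = chi q 2 • 1 - (q - q⁻¹) ^ 2 • e q := by
  rw [e, smul_inv_smul₀ (pow_ne_zero _ (sub_inv_ne_zero hq h2)), sub_sub_cancel]

theorem mk_B_eq (hq : q ≠ 0) (h2 : q ^ 2 ≠ 1) :
    mk q 1 1 1 (AW3.B q) = chi q 2 • 1 - (q - q⁻¹) ^ 2 • f q := by
  rw [f, smul_inv_smul₀ (pow_ne_zero _ (sub_inv_ne_zero hq h2)), sub_sub_cancel]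

theorem sq_of_chi_rel {R : Type*} [Ring R] [Algebra ℂ R] (hq : q ≠ 0) (h2 : q ^ 2 ≠ 1) {y : R}
    (h : (chi q 2 • 1 - (q - q⁻¹) ^ 2 • y - algebraMap ℂ R (chi q 0)) *
      (chi q 2 • 1 - (q - q⁻¹) ^ 2 • y - algebraMap ℂ R (chi q 2)) = 0) :
    y * y = (q + q⁻¹) • y := by
  have h0 : chi q 0 = chi q 2 - (q - q⁻¹) ^ 2 * (q + q⁻¹) := by
    simp only [chi]; field_simp; ring
  have hs : (q - q⁻¹) ^ 4 ≠ 0 := pow_ne_zero _ (sub_inv_ne_zero hq h2)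
  rw [← sub_eq_zero, ← smul_eq_zero_iff_right hs, ← h, h0]
  simp only [Algebra.algebraMap_eq_smul_one, sub_mul, mul_sub, smul_mul_assoc, mul_smul_comm,
    one_mul, mul_one]
  module

theorem structure_eq (hq : q ≠ 0) (hroot : ∀ n : ℕ, 0 < n → q ^ n ≠ 1) :
    IsTL q (e q) (f q) ∧ mk q 1 1 1 (AW3.K q) = tlK q (e q) (f q) := by
  have h2 := hroot 2 (by norm_num)
  have h13 := sub_ne_zero.2 (chi_one_ne_chi_three hq (hroot 6 (by norm_num))).symm
  have hs : (q - q⁻¹) ^ 2 ≠ 0 := pow_ne_zero _ (sub_inv_ne_zero hq h2)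
  have hα₁ := mk_rel (AWBarRel.α₁ (q := q) (n₁ := 1) (n₂ := 1) (n₃ := 1))
  have hα₂ := mk_rel (AWBarRel.α₂ (q := q) (n₁ := 1) (n₂ := 1) (n₃ := 1))
  have hα₃ := mk_rel (AWBarRel.α₃ (q := q) (n₁ := 1) (n₂ := 1) (n₃ := 1))
  have hA := mk_rel (AWBarRel.A (q := q) (n₁ := 1) (n₂ := 1) (n₃ := 1))
  have hB := mk_rel (AWBarRel.B (q := q) (n₁ := 1) (n₂ := 1) (n₃ := 1))
  have hD := mk_rel (AWBarRel.D (q := q) (n₁ := 1) (n₂ := 1) (n₃ := 1))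
  have hK := mk_rel (AWBarRel.K (q := q) (n₁ := 1) (n₂ := 1) (n₃ := 1))
  have hKA := mk_rel (AWBarRel.K_sub_A (q := q) (n₁ := 1) (n₂ := 1) (n₃ := 1))
  have hKB := mk_rel (AWBarRel.K_sub_B (q := q) (n₁ := 1) (n₂ := 1) (n₃ := 1))
  have hcA : Commute (mk q 1 1 1 (AW3.K q)) (mk q 1 1 1 (AW3.A q)) :=
    Commute.map (AW3.central_mul q (c := .K) (x := .A) trivial) (mk q 1 1 1)
  have hcB : Commute (mk q 1 1 1 (AW3.K q)) (mk q 1 1 1 (AW3.B q)) :=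
    Commute.map (AW3.central_mul q (c := .K) (x := .B) trivial) (mk q 1 1 1)
  have hBD := congrArg (mk q 1 1 1) (AW3.rel_BD q)
  have hDA := congrArg (mk q 1 1 1) (AW3.rel_DA q)
  have hAB := congrArg (mk q 1 1 1) (AW3.rel_AB q)
  simp only [map_add, map_mul, map_smul, map_qComm, hα₁, hα₂, hα₃, map_zero, map_sub,
    AlgHom.commutes, chiProd_spinJ_one_one, chiProd_spinJ₃_one_one_one,
    rootProd_spinM_one_one_one hq hroot] at hA hB hD hK hKA hKB hBD hDA hAB
  have hpA := mul_sub_chi_two_eq_zero hq hroot hcA hK hA (by simpa only [map_sub] using hKA)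
  have hpB := mul_sub_chi_two_eq_zero hq hroot hcB hK hB (by simpa only [map_sub] using hKB)
  rw [mk_A_eq hq h2] at *
  rw [mk_B_eq hq h2] at *
  generalize hp : (chi q 3 - chi q 1)⁻¹ • (mk q 1 1 1 (AW3.K q) - chi q 1 • 1) = p
  have hKp : mk q 1 1 1 (AW3.K q) = chi q 1 • 1 + (chi q 3 - chi q 1) • p := by
    rw [← hp, smul_inv_smul₀ h13, add_sub_cancel]
  clear hp
  generalize mk q 1 1 1 (AW3.K q) = K at *
  subst hKp
  generalize mk q 1 1 1 (AW3.D q) = D at *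
  have hee := sq_of_chi_rel hq h2 hA
  have hff := sq_of_chi_rel hq h2 hB
  have hc : -((chi q 3 - chi q 1) * (q - q⁻¹) ^ 2) ≠ 0 := neg_ne_zero.2 (mul_ne_zero h13 hs)
  have hpe : p * e q = 0 := by
    rw [← smul_eq_zero_iff_right hc, ← hpA]
    simp only [Algebra.algebraMap_eq_smul_one, sub_mul, add_mul, mul_sub, smul_mul_assoc,
      mul_smul_comm, one_mul, mul_one]
    module
  have hpf : p * f q = 0 := by
    rw [← smul_eq_zero_iff_right hc, ← hpB]
    simp only [Algebra.algebraMap_eq_smul_one, sub_mul, add_mul, mul_sub, smul_mul_assoc,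
      mul_smul_comm, one_mul, mul_one]
    module
  have hep : e q * p = 0 := by
    rw [← hpe, ← sub_eq_zero, ← smul_eq_zero_iff_right (mul_ne_zero h13 hs),
      ← sub_eq_zero.2 hcA.eq]
    simp only [sub_mul, add_mul, mul_sub, mul_add, smul_mul_assoc,
      mul_smul_comm, one_mul, mul_one]
    module
  have hfp : f q * p = 0 := by
    rw [← hpf, ← sub_eq_zero, ← smul_eq_zero_iff_right (mul_ne_zero h13 hs),
      ← sub_eq_zero.2 hcB.eq]
    simp only [sub_mul, add_mul, mul_sub, mul_add, smul_mul_assoc,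
      mul_smul_comm, one_mul, mul_one]
    module
  have hpp : p * p = p := by
    rw [← sub_eq_zero, ← smul_eq_zero_iff_right (mul_ne_zero h13 h13), ← hK]
    simp only [Algebra.algebraMap_eq_smul_one, sub_mul, add_mul, mul_sub, mul_add, smul_mul_assoc,
      mul_smul_comm, one_mul, mul_one]
    module
  simp only [Algebra.algebraMap_eq_smul_one, smul_mul_assoc, one_mul] at hBD hDA hAB hD
  simp only [smul_smul] at hBD hDA hAB
  have hDeq : D = awD q (e q) (f q) p := by
    rw [awD, ← hAB, add_sub_cancel_right]
  subst hDeq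
  obtain ⟨hTL, hJ⟩ := isTL_of_awRel hq (hroot 4 (by norm_num)) hee hff hep hpe hfp hpf
    (hroot 6 (by norm_num)) (hroot 8 (by norm_num)) hpp hBD hDA hD
  refine ⟨hTL, ?_⟩
  rw [tlK_eq hq, hJ, smul_smul]
  congr 2
  simp only [chi]; field_simp; ring

theorem mk_D_eq : mk q 1 1 1 (AW3.D q) =
    (q + q⁻¹)⁻¹ • (algebraMap ℂ _ (chi q 1) * algebraMap ℂ _ (chi q 1) +
      algebraMap ℂ _ (chi q 1) * mk q 1 1 1 (AW3.K q)) -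
    (q ^ 2 - (q ^ 2)⁻¹)⁻¹ • qComm q (mk q 1 1 1 (AW3.A q)) (mk q 1 1 1 (AW3.B q)) := by
  have hAB := congrArg (mk q 1 1 1) (AW3.rel_AB q)
  have hα₁ := mk_rel (AWBarRel.α₁ (q := q) (n₁ := 1) (n₂ := 1) (n₃ := 1))
  have hα₂ := mk_rel (AWBarRel.α₂ (q := q) (n₁ := 1) (n₂ := 1) (n₃ := 1))
  have hα₃ := mk_rel (AWBarRel.α₃ (q := q) (n₁ := 1) (n₂ := 1) (n₃ := 1))
  simp only [map_add, map_mul, map_smul, map_qComm, hα₁, hα₂, hα₃, AlgHom.commutes] at hAB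
  rw [← hAB, add_sub_cancel_right]

/-- An algebra map on the quotient is determined by the images of `A`, `B`, `K`. -/
theorem algHom_ext {R : Type*} [Ring R] [Algebra ℂ R] {φ ψ : AWBar q 1 1 1 →ₐ[ℂ] R}
    (hA : φ (mk q 1 1 1 (AW3.A q)) = ψ (mk q 1 1 1 (AW3.A q)))
    (hB : φ (mk q 1 1 1 (AW3.B q)) = ψ (mk q 1 1 1 (AW3.B q)))
    (hK : φ (mk q 1 1 1 (AW3.K q)) = ψ (mk q 1 1 1 (AW3.K q))) : φ = ψ := by
  have h : (φ.comp (mk q 1 1 1)).comp (AW3.mk q) = (ψ.comp (mk q 1 1 1)).comp (AW3.mk q) := by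
    refine FreeAlgebra.hom_ext (funext fun x => ?_)
    cases x
    · exact hA
    · exact hB
    · change φ (mk q 1 1 1 (AW3.D q)) = ψ (mk q 1 1 1 (AW3.D q))
      simp only [mk_D_eq, map_add, map_sub, map_mul, map_smul, map_qComm, AlgHom.commutes, hA, hB,
        hK]
    · change φ (mk q 1 1 1 (AW3.α₁ q)) = ψ (mk q 1 1 1 (AW3.α₁ q))
      simp only [mk_rel .α₁, AlgHom.commutes]
    · change φ (mk q 1 1 1 (AW3.α₂ q)) = ψ (mk q 1 1 1 (AW3.α₂ q))
      simp only [mk_rel .α₂, AlgHom.commutes]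
    · change φ (mk q 1 1 1 (AW3.α₃ q)) = ψ (mk q 1 1 1 (AW3.α₃ q))
      simp only [mk_rel .α₃, AlgHom.commutes]
    · exact hK
  ext x
  obtain ⟨y, rfl⟩ := mk_surjective q 1 1 1 x
  obtain ⟨z, rfl⟩ := AW3.mk_surjective q y
  exact DFunLike.congr_fun h z

theorem add_inv_ne_zero (hq : q ≠ 0) (h4 : q ^ 4 ≠ 1) : q + q⁻¹ ≠ 0 := by
  intro h
  apply h4
  field_simp at h
  linear_combination (q ^ 2 - 1) * h

theorem sq_sub_inv_ne_zero (hq : q ≠ 0) (h4 : q ^ 4 ≠ 1) : q ^ 2 - (q ^ 2)⁻¹ ≠ 0 := by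
  intro h
  apply h4
  field_simp at h
  linear_combination h

theorem exists_eq_tlWord (hq : q ≠ 0) (hroot : ∀ n : ℕ, 0 < n → q ^ n ≠ 1) (x : AWBar q 1 1 1) :
    ∃ a b c d g, x = tlWord (e q) (f q) a b c d g := by
  obtain ⟨hTL, hK⟩ := structure_eq hq hroot
  have h2 := hroot 2 (by norm_num)
  have h4 := hroot 4 (by norm_num)
  have hA : mk q 1 1 1 (AW3.A q) = tlAW q (e q) (f q) 1 0 0 0 := by
    rw [mk_A_eq hq h2, tlAW_eq]; simp [tlWord]
  have hB : mk q 1 1 1 (AW3.B q) = tlAW q (e q) (f q) 0 1 0 0 := by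
    rw [mk_B_eq hq h2, tlAW_eq]; simp [tlWord]
  have hD : mk q 1 1 1 (AW3.D q) = tlAW q (e q) (f q) 1 1 (-q⁻¹) (-q) := by
    rw [mk_D_eq, hA, hB, hK,
      ← hTL.relAB hq (add_inv_ne_zero hq h4) (sq_sub_inv_ne_zero hq h4), add_sub_cancel_right]
  obtain ⟨y, rfl⟩ := mk_surjective q 1 1 1 x
  obtain ⟨z, rfl⟩ := AW3.mk_surjective q y
  induction z using FreeAlgebra.induction with
  | grade0 k =>
    exact ⟨k, 0, 0, 0, 0, by rw [AlgHom.commutes, AlgHom.commutes, algebraMap_eq_tlWord]⟩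
  | grade1 x =>
    cases x
    · exact ⟨_, _, _, _, _, hA⟩
    · exact ⟨_, _, _, _, _, hB⟩
    · exact ⟨_, _, _, _, _, hD⟩
    · exact ⟨_, _, _, _, _,
        (mk_rel .α₁).trans ((AlgHom.commutes _ _).trans (algebraMap_eq_tlWord _))⟩
    · exact ⟨_, _, _, _, _,
        (mk_rel .α₂).trans ((AlgHom.commutes _ _).trans (algebraMap_eq_tlWord _))⟩
    · exact ⟨_, _, _, _, _,
        (mk_rel .α₃).trans ((AlgHom.commutes _ _).trans (algebraMap_eq_tlWord _))⟩
    · exact ⟨_, _, _, _, _, hK⟩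
  | mul x y hx hy =>
    obtain ⟨_, _, _, _, _, hx⟩ := hx
    obtain ⟨_, _, _, _, _, hy⟩ := hy
    exact ⟨_, _, _, _, _, by rw [map_mul, map_mul, hx, hy, hTL.tlWord_mul]⟩
  | add x y hx hy =>
    obtain ⟨_, _, _, _, _, hx⟩ := hx
    obtain ⟨_, _, _, _, _, hy⟩ := hy
    exact ⟨_, _, _, _, _, by rw [map_add, map_add, hx, hy, tlWord_add]⟩

end AWBar

section Lift

variable {R : Type*} [Ring R] [Algebra ℂ R] {q : ℂ} {e f : R}

/-- The images of the Askey–Wilson generators in a Temperley–Lieb algebra. -/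
noncomputable def awImage (q : ℂ) (e f : R) : AWGen → R
  | .A => tlAW q e f 1 0 0 0
  | .B => tlAW q e f 0 1 0 0
  | .D => tlAW q e f 1 1 (-q⁻¹) (-q)
  | .α₁ | .α₂ | .α₃ => algebraMap ℂ R (chi q 1)
  | .K => tlK q e f

theorem exists_awImage_eq_tlWord (x : AWGen) : ∃ a b c d g, awImage q e f x =
    tlWord e f a b c d g := by
  cases x
  case α₁ | α₂ | α₃ => exact ⟨_, _, _, _, _, algebraMap_eq_tlWord _⟩
  all_goals exact ⟨_, _, _, _, _, rfl⟩

theorem IsTL.awImage_central (h : IsTL q e f) {c : AWGen} (hc : c.IsCentral) (x : AWGen) :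
    awImage q e f c * awImage q e f x = awImage q e f x * awImage q e f c := by
  obtain ⟨_, _, _, _, _, hx⟩ := exists_awImage_eq_tlWord (q := q) (e := e) (f := f) x
  cases c
  case A | B | D => exact hc.elim
  case K => rw [hx]; exact h.tlK_mul _ _ _ _ _
  all_goals exact Algebra.commutes _ _

/-- The algebra map `AW(3) → R` determined by a Temperley–Lieb pair in `R`. -/
noncomputable def IsTL.aw3Hom (h : IsTL q e f) (hq : q ≠ 0) (h4 : q ^ 4 ≠ 1) : AW3 q →ₐ[ℂ] R :=
  RingQuot.liftAlgHom ℂ ⟨FreeAlgebra.lift ℂ (awImage q e f), by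
    have h2 := AWBar.add_inv_ne_zero hq h4
    have h4' := AWBar.sq_sub_inv_ne_zero hq h4
    intro x y hxy
    cases hxy with
    | central c x hc => simpa using h.awImage_central hc x
    | BD => simpa [map_qComm, awImage] using h.relBD hq h2 h4'
    | DA => simpa [map_qComm, awImage] using h.relDA hq h2 h4'
    | AB => simpa [map_qComm, awImage] using h.relAB hq h2 h4'⟩

theorem IsTL.aw3Hom_gen (h : IsTL q e f) (hq : q ≠ 0) (h4 : q ^ 4 ≠ 1) (x : AWGen) :
    h.aw3Hom hq h4 (AW3.gen q x) = awImage q e f x := by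
  simp only [aw3Hom, AW3.gen, AW3.mk]
  erw [RingQuot.liftAlgHom_mkAlgHom_apply]
  simp

theorem isTLGenerator_e (q : ℂ) : IsTLGenerator q 1 0 0 0 := by
  constructor <;> ring

theorem isTLGenerator_f (q : ℂ) : IsTLGenerator q 0 1 0 0 := by
  constructor <;> ring

theorem isTLGenerator_braid (hq : q ≠ 0) : IsTLGenerator q 1 1 (-q⁻¹) (-q) := by
  constructor <;> field_simp <;> ring

theorem isTLGenerator_braid' (hq : q ≠ 0) : IsTLGenerator q 1 1 (-q) (-q⁻¹) := by
  constructor <;> field_simp <;> ring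

/-- The algebra map from the quotient of the Askey–Wilson algebra to `R` determined by a
Temperley–Lieb pair in `R`. -/
noncomputable def IsTL.awBarHom (h : IsTL q e f) (hq : q ≠ 0)
    (hroot : ∀ n : ℕ, 0 < n → q ^ n ≠ 1) : AWBar q 1 1 1 →ₐ[ℂ] R :=
  RingQuot.liftAlgHom ℂ ⟨h.aw3Hom hq (hroot 4 (by norm_num)), by
    have h4 := hroot 4 (by norm_num)
    have hA : h.aw3Hom hq h4 (AW3.A q) = tlAW q e f 1 0 0 0 := h.aw3Hom_gen hq h4 .A
    have hB : h.aw3Hom hq h4 (AW3.B q) = tlAW q e f 0 1 0 0 := h.aw3Hom_gen hq h4 .B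
    have hD : h.aw3Hom hq h4 (AW3.D q) = tlAW q e f 1 1 (-q⁻¹) (-q) := h.aw3Hom_gen hq h4 .D
    have hK : h.aw3Hom hq h4 (AW3.K q) = tlK q e f := h.aw3Hom_gen hq h4 .K
    have hα₁ : h.aw3Hom hq h4 (AW3.α₁ q) = algebraMap ℂ R (chi q 1) := h.aw3Hom_gen hq h4 .α₁
    have hα₂ : h.aw3Hom hq h4 (AW3.α₂ q) = algebraMap ℂ R (chi q 1) := h.aw3Hom_gen hq h4 .α₂
    have hα₃ : h.aw3Hom hq h4 (AW3.α₃ q) = algebraMap ℂ R (chi q 1) := h.aw3Hom_gen hq h4 .α₃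
    have hD' : h.aw3Hom hq h4 (AW3.D' q) = tlAW q e f 1 1 (-q) (-q⁻¹) := by
      rw [← h.relBA hq (AWBar.add_inv_ne_zero hq h4) (AWBar.sq_sub_inv_ne_zero hq h4), AW3.D']
      simp only [map_add, map_sub, map_mul, map_smul, map_qComm, hA, hB, hK, hα₁, hα₂, hα₃]
    intro x y hxy
    cases hxy with
    | α₁ => rw [hα₁, AlgHom.commutes]
    | α₂ => rw [hα₂, AlgHom.commutes]
    | α₃ => rw [hα₃, AlgHom.commutes]
    | A => rw [map_chiProd, hA, chiProd_spinJ_one_one, map_zero, h.chi_rel hq (isTLGenerator_e q)]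
    | B => rw [map_chiProd, hB, chiProd_spinJ_one_one, map_zero, h.chi_rel hq (isTLGenerator_f q)]
    | K => rw [map_chiProd, hK, chiProd_spinJ₃_one_one_one, map_zero, h.chi_relK hq]
    | D =>
      rw [map_chiProd, hD, chiProd_spinJ_one_one, map_zero, h.chi_rel hq (isTLGenerator_braid hq)]
    | D' =>
      rw [map_chiProd, hD', chiProd_spinJ_one_one, map_zero,
        h.chi_rel hq (isTLGenerator_braid' hq)]
    | K_sub_A =>
      rw [map_rootProd, map_sub, hK, hA, rootProd_spinM_one_one_one hq hroot, map_zero,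
        h.root_rel hq (isTLGenerator_e q)]
    | K_sub_B =>
      rw [map_rootProd, map_sub, hK, hB, rootProd_spinM_one_one_one hq hroot, map_zero,
        h.root_rel hq (isTLGenerator_f q)]
    | K_sub_D =>
      rw [map_rootProd, map_sub, hK, hD, rootProd_spinM_one_one_one hq hroot, map_zero,
        h.root_rel hq (isTLGenerator_braid hq)]
    | K_sub_D' =>
      rw [map_rootProd, map_sub, hK, hD', rootProd_spinM_one_one_one hq hroot, map_zero,
        h.root_rel hq (isTLGenerator_braid' hq)]
    | Ω =>
      simp only [AW3.Ω, map_add, map_sub, map_mul, map_smul, map_pow, AlgHom.commutes, hA, hB, hD,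
        hK, hα₁, hα₂, hα₃]
      simpa only [map_add, map_mul, map_pow] using h.relΩ hq⟩

theorem IsTL.awBarHom_mk_gen (h : IsTL q e f) (hq : q ≠ 0)
    (hroot : ∀ n : ℕ, 0 < n → q ^ n ≠ 1) (x : AWGen) :
    h.awBarHom hq hroot (AWBar.mk q 1 1 1 (AW3.gen q x)) = awImage q e f x := by
  simp only [awBarHom, AWBar.mk]
  erw [RingQuot.liftAlgHom_mkAlgHom_apply]
  exact h.aw3Hom_gen hq _ x

end Lift

namespace Uq

variable {q : ℂ} {R : Type*} [Ring R] [Algebra ℂ R] {e f k k' : R}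
    (h₁ : k * k' = 1) (h₂ : k' * k = 1) (h₃ : k * e = q • (e * k)) (h₄ : k * f = q⁻¹ • (f * k))
    (h₅ : e * f - f * e = (q - q⁻¹)⁻¹ • (k ^ 2 - k' ^ 2))

theorem lift_E : lift e f k k' h₁ h₂ h₃ h₄ h₅ (E q) = e := by
  simp only [lift, E, gen, mk]
  erw [RingQuot.liftAlgHom_mkAlgHom_apply]
  simp

theorem lift_F : lift e f k k' h₁ h₂ h₃ h₄ h₅ (F q) = f := by
  simp only [lift, F, gen, mk]
  erw [RingQuot.liftAlgHom_mkAlgHom_apply]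
  simp

theorem lift_qH : lift e f k k' h₁ h₂ h₃ h₄ h₅ (qH q) = k := by
  simp only [lift, qH, gen, mk]
  erw [RingQuot.liftAlgHom_mkAlgHom_apply]
  simp

theorem lift_qHinv : lift e f k k' h₁ h₂ h₃ h₄ h₅ (qHinv q) = k' := by
  simp only [lift, qHinv, gen, mk]
  erw [RingQuot.liftAlgHom_mkAlgHom_apply]
  simp

/-- Elements commuting with the images of the generators commute with the image of the algebra. -/
theorem commute_of_gen (φ : Uq q →ₐ[ℂ] R) {m : R} (hE : Commute m (φ (E q)))
    (hF : Commute m (φ (F q))) (hK : Commute m (φ (qH q))) (hK' : Commute m (φ (qHinv q)))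
    (x : Uq q) : Commute m (φ x) := by
  obtain ⟨y, rfl⟩ := RingQuot.mkAlgHom_surjective ℂ (UqRel q) x
  induction y using FreeAlgebra.induction with
  | grade0 c =>
    rw [AlgHom.commutes]
    erw [AlgHom.commutes]
    exact Algebra.commute_algebraMap_right _ _
  | grade1 x =>
    cases x
    · exact hE
    · exact hF
    · exact hK
    · exact hK'
  | mul x y hx hy =>
    rw [map_mul]
    erw [map_mul]
    exact hx.mul_right hy
  | add x y hx hy =>
    rw [map_add]
    erw [map_add]
    exact hx.add_right hy

variable (hq : q ≠ 0)

theorem comul_E : comul hq (E q) = E q ⊗ₜ qHinv q + qH q ⊗ₜ E q := lift_E ..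
theorem comul_F : comul hq (F q) = F q ⊗ₜ qHinv q + qH q ⊗ₜ F q := lift_F ..
theorem comul_qH : comul hq (qH q) = qH q ⊗ₜ qH q := lift_qH ..
theorem comul_qHinv : comul hq (qHinv q) = qHinv q ⊗ₜ qHinv q := lift_qHinv ..

/-- `x ↦ Δ(x) ⊗ 1`. -/
noncomputable def comul₁₂ : Uq q →ₐ[ℂ] Uq q ⊗[ℂ] (Uq q ⊗[ℂ] Uq q) :=
  ((Algebra.TensorProduct.assoc ℂ ℂ ℂ (Uq q) (Uq q) (Uq q)).toAlgHom.comp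
    Algebra.TensorProduct.includeLeft).comp (comul hq)

/-- `x ↦ 1 ⊗ Δ(x)`. -/
noncomputable def comul₂₃ : Uq q →ₐ[ℂ] Uq q ⊗[ℂ] (Uq q ⊗[ℂ] Uq q) :=
  Algebra.TensorProduct.includeRight.comp (comul hq)

theorem map_casimir (φ : Uq q →ₐ[ℂ] R) : φ (casimir q) =
    (q - q⁻¹) ^ 2 • (φ (F q) * φ (E q)) + q • φ (qH q) ^ 2 + q⁻¹ • φ (qHinv q) ^ 2 := by
  simp [casimir]

end Uq

/-- The standard basis of the spin-`1/2` representation. -/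
def halfVec (i : Fin 2) : SpinSpace 1 := Pi.single i 1

/-- The standard basis of the tensor cube of the spin-`1/2` representation. -/
noncomputable def halfVec₃ (i j k : Fin 2) : SpinSpace 1 ⊗[ℂ] (SpinSpace 1 ⊗[ℂ] SpinSpace 1) :=
  halfVec i ⊗ₜ (halfVec j ⊗ₜ halfVec k)

/-- `halfVec₃` as a basis. -/
noncomputable def halfBasis : Module.Basis (Fin 2 × (Fin 2 × Fin 2)) ℂ
    (SpinSpace 1 ⊗[ℂ] (SpinSpace 1 ⊗[ℂ] SpinSpace 1)) :=
  (Pi.basisFun ℂ (Fin 2)).tensorProduct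
    ((Pi.basisFun ℂ (Fin 2)).tensorProduct (Pi.basisFun ℂ (Fin 2)))

theorem halfBasis_apply (i j k : Fin 2) : halfBasis (i, j, k) = halfVec₃ i j k := by
  simp [halfBasis, halfVec₃, halfVec]

theorem end₃_ext {m m' : End₃ 1 1 1}
    (h : ∀ i j k, m (halfVec₃ i j k) = m' (halfVec₃ i j k)) : m = m' :=
  halfBasis.ext fun ⟨i, j, k⟩ => by rw [halfBasis_apply]; exact h i j k

section Rep

variable {q r : ℂ} (hq : q ≠ 0) (hr : r ^ 2 = q)

theorem spinRep_E (n : ℕ) (x : SpinSpace n) :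
    spinRep hq hr n (Uq.E q) x = (spinE q n).mulVec x := by
  simp only [spinRep, AlgHom.comp_apply, Uq.lift_E]
  rfl

theorem spinRep_F (n : ℕ) (x : SpinSpace n) :
    spinRep hq hr n (Uq.F q) x = (spinF n).mulVec x := by
  simp only [spinRep, AlgHom.comp_apply, Uq.lift_F]
  rfl

theorem spinRep_qH (n : ℕ) (x : SpinSpace n) :
    spinRep hq hr n (Uq.qH q) x = (spinQH r n).mulVec x := by
  simp only [spinRep, AlgHom.comp_apply, Uq.lift_qH]
  rfl

theorem spinRep_qHinv (n : ℕ) (x : SpinSpace n) :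
    spinRep hq hr n (Uq.qHinv q) x = (spinQHinv r n).mulVec x := by
  simp only [spinRep, AlgHom.comp_apply, Uq.lift_qHinv]
  rfl

theorem E_halfVec_zero : spinRep hq hr 1 (Uq.E q) (halfVec 0) = 0 := by
  rw [spinRep_E]
  ext i
  fin_cases i <;> simp [spinE, halfVec]

theorem E_halfVec_one (h2 : q ^ 2 ≠ 1) : spinRep hq hr 1 (Uq.E q) (halfVec 1) = halfVec 0 := by
  have := AWBar.sub_inv_ne_zero hq h2
  rw [spinRep_E]
  ext i
  fin_cases i <;> simp [spinE, halfVec, qNum, this]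

theorem F_halfVec_zero : spinRep hq hr 1 (Uq.F q) (halfVec 0) = halfVec 1 := by
  rw [spinRep_F]
  ext i
  fin_cases i <;> simp [spinF, halfVec]

theorem F_halfVec_one : spinRep hq hr 1 (Uq.F q) (halfVec 1) = 0 := by
  rw [spinRep_F]
  ext i
  fin_cases i <;> simp [spinF, halfVec]

theorem qH_halfVec_zero : spinRep hq hr 1 (Uq.qH q) (halfVec 0) = r • halfVec 0 := by
  rw [spinRep_qH]
  ext i
  fin_cases i <;> simp [spinQH, halfVec]

theorem qH_halfVec_one : spinRep hq hr 1 (Uq.qH q) (halfVec 1) = r⁻¹ • halfVec 1 := by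
  rw [spinRep_qH]
  ext i
  fin_cases i <;> simp [spinQH, halfVec]

theorem qHinv_halfVec_zero : spinRep hq hr 1 (Uq.qHinv q) (halfVec 0) = r⁻¹ • halfVec 0 := by
  rw [spinRep_qHinv]
  ext i
  fin_cases i <;> simp [spinQHinv, halfVec]

theorem qHinv_halfVec_one : spinRep hq hr 1 (Uq.qHinv q) (halfVec 1) = r • halfVec 1 := by
  rw [spinRep_qHinv]
  ext i
  fin_cases i <;> simp [spinQHinv, halfVec]

theorem spinRep₃_tmul (n₁ n₂ n₃ : ℕ) (a b c : Uq q) (x : SpinSpace n₁) (y : SpinSpace n₂)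
    (z : SpinSpace n₃) : spinRep₃ hq hr n₁ n₂ n₃ (a ⊗ₜ (b ⊗ₜ c)) (x ⊗ₜ (y ⊗ₜ z)) =
      spinRep hq hr n₁ a x ⊗ₜ (spinRep hq hr n₂ b y ⊗ₜ spinRep hq hr n₃ c z) := by
  simp [spinRep₃, Module.endTensorEndAlgHom_apply]

theorem comul₁₂_E : Uq.comul₁₂ hq (Uq.E q) =
    Uq.E q ⊗ₜ (Uq.qHinv q ⊗ₜ 1) + Uq.qH q ⊗ₜ (Uq.E q ⊗ₜ 1) := by
  simp [Uq.comul₁₂, Uq.comul_E, TensorProduct.add_tmul]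

theorem comul₁₂_F : Uq.comul₁₂ hq (Uq.F q) =
    Uq.F q ⊗ₜ (Uq.qHinv q ⊗ₜ 1) + Uq.qH q ⊗ₜ (Uq.F q ⊗ₜ 1) := by
  simp [Uq.comul₁₂, Uq.comul_F, TensorProduct.add_tmul]

theorem comul₁₂_qH : Uq.comul₁₂ hq (Uq.qH q) = Uq.qH q ⊗ₜ (Uq.qH q ⊗ₜ 1) := by
  simp [Uq.comul₁₂, Uq.comul_qH]

theorem comul₁₂_qHinv : Uq.comul₁₂ hq (Uq.qHinv q) = Uq.qHinv q ⊗ₜ (Uq.qHinv q ⊗ₜ 1) := by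
  simp [Uq.comul₁₂, Uq.comul_qHinv]

theorem comul₂₃_E : Uq.comul₂₃ hq (Uq.E q) =
    1 ⊗ₜ (Uq.E q ⊗ₜ Uq.qHinv q) + 1 ⊗ₜ (Uq.qH q ⊗ₜ Uq.E q) := by
  simp [Uq.comul₂₃, Uq.comul_E, TensorProduct.tmul_add]

theorem comul₂₃_F : Uq.comul₂₃ hq (Uq.F q) =
    1 ⊗ₜ (Uq.F q ⊗ₜ Uq.qHinv q) + 1 ⊗ₜ (Uq.qH q ⊗ₜ Uq.F q) := by
  simp [Uq.comul₂₃, Uq.comul_F, TensorProduct.tmul_add]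

theorem comul₂₃_qH : Uq.comul₂₃ hq (Uq.qH q) = 1 ⊗ₜ (Uq.qH q ⊗ₜ Uq.qH q) := by
  simp [Uq.comul₂₃, Uq.comul_qH]

theorem comul₂₃_qHinv : Uq.comul₂₃ hq (Uq.qHinv q) = 1 ⊗ₜ (Uq.qHinv q ⊗ₜ Uq.qHinv q) := by
  simp [Uq.comul₂₃, Uq.comul_qHinv]

theorem comul₂_E : Uq.comul₂ hq (Uq.E q) = Uq.E q ⊗ₜ (Uq.qHinv q ⊗ₜ Uq.qHinv q) +
    (Uq.qH q ⊗ₜ (Uq.E q ⊗ₜ Uq.qHinv q) + Uq.qH q ⊗ₜ (Uq.qH q ⊗ₜ Uq.E q)) := by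
  simp [Uq.comul₂, Uq.comul_E, Uq.comul_qHinv, TensorProduct.tmul_add]

theorem comul₂_F : Uq.comul₂ hq (Uq.F q) = Uq.F q ⊗ₜ (Uq.qHinv q ⊗ₜ Uq.qHinv q) +
    (Uq.qH q ⊗ₜ (Uq.F q ⊗ₜ Uq.qHinv q) + Uq.qH q ⊗ₜ (Uq.qH q ⊗ₜ Uq.F q)) := by
  simp [Uq.comul₂, Uq.comul_F, Uq.comul_qHinv, TensorProduct.tmul_add]

theorem comul₂_qH : Uq.comul₂ hq (Uq.qH q) = Uq.qH q ⊗ₜ (Uq.qH q ⊗ₜ Uq.qH q) := by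
  simp [Uq.comul₂, Uq.comul_qH]

theorem comul₂_qHinv :
    Uq.comul₂ hq (Uq.qHinv q) = Uq.qHinv q ⊗ₜ (Uq.qHinv q ⊗ₜ Uq.qHinv q) := by
  simp [Uq.comul₂, Uq.comul_qHinv]

/-- The action of `Δ(Γ) ⊗ 1` on the tensor cube of the spin-`1/2` representation. -/
noncomputable def halfC₁₂ : End₃ 1 1 1 := spinRep₃ hq hr 1 1 1 (Uq.casimir₁₂ hq)

/-- The action of `1 ⊗ Δ(Γ)` on the tensor cube of the spin-`1/2` representation. -/
noncomputable def halfC₂₃ : End₃ 1 1 1 := spinRep₃ hq hr 1 1 1 (Uq.casimir₂₃ hq)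

/-- The action of `Δ⁽²⁾(Γ)` on the tensor cube of the spin-`1/2` representation. -/
noncomputable def halfC₁₂₃ : End₃ 1 1 1 := spinRep₃ hq hr 1 1 1 (Uq.casimir₁₂₃ hq)

theorem halfC₁₂_eq : halfC₁₂ hq hr =
    (q - q⁻¹) ^ 2 • (spinRep₃ hq hr 1 1 1 (Uq.comul₁₂ hq (Uq.F q)) *
      spinRep₃ hq hr 1 1 1 (Uq.comul₁₂ hq (Uq.E q))) +
    q • spinRep₃ hq hr 1 1 1 (Uq.comul₁₂ hq (Uq.qH q)) ^ 2 +
    q⁻¹ • spinRep₃ hq hr 1 1 1 (Uq.comul₁₂ hq (Uq.qHinv q)) ^ 2 :=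
  Uq.map_casimir (R := End₃ 1 1 1) ((spinRep₃ hq hr 1 1 1).comp (Uq.comul₁₂ hq))

theorem halfC₂₃_eq : halfC₂₃ hq hr =
    (q - q⁻¹) ^ 2 • (spinRep₃ hq hr 1 1 1 (Uq.comul₂₃ hq (Uq.F q)) *
      spinRep₃ hq hr 1 1 1 (Uq.comul₂₃ hq (Uq.E q))) +
    q • spinRep₃ hq hr 1 1 1 (Uq.comul₂₃ hq (Uq.qH q)) ^ 2 +
    q⁻¹ • spinRep₃ hq hr 1 1 1 (Uq.comul₂₃ hq (Uq.qHinv q)) ^ 2 :=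
  Uq.map_casimir (R := End₃ 1 1 1) ((spinRep₃ hq hr 1 1 1).comp (Uq.comul₂₃ hq))

theorem halfC₁₂₃_eq : halfC₁₂₃ hq hr =
    (q - q⁻¹) ^ 2 • (spinRep₃ hq hr 1 1 1 (Uq.comul₂ hq (Uq.F q)) *
      spinRep₃ hq hr 1 1 1 (Uq.comul₂ hq (Uq.E q))) +
    q • spinRep₃ hq hr 1 1 1 (Uq.comul₂ hq (Uq.qH q)) ^ 2 +
    q⁻¹ • spinRep₃ hq hr 1 1 1 (Uq.comul₂ hq (Uq.qHinv q)) ^ 2 :=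
  Uq.map_casimir (R := End₃ 1 1 1) ((spinRep₃ hq hr 1 1 1).comp (Uq.comul₂ hq))

end Rep

section Action

set_option linter.unusedSimpArgs false

variable {q r : ℂ} (hq : q ≠ 0) (hr : r ^ 2 = q)

/-- The first Temperley–Lieb generator acting on the tensor cube. -/
noncomputable def halfE₁ : End₃ 1 1 1 := ((q - q⁻¹) ^ 2)⁻¹ • (chi q 2 • 1 - halfC₁₂ hq hr)

/-- The second Temperley–Lieb generator acting on the tensor cube. -/
noncomputable def halfE₂ : End₃ 1 1 1 := ((q - q⁻¹) ^ 2)⁻¹ • (chi q 2 • 1 - halfC₂₃ hq hr)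

local notation "ρ" => spinRep₃ hq hr 1 1 1

theorem halfE₁_halfVec₃ (k : Fin 2) (h2 : q ^ 2 ≠ 1) :
    halfE₁ hq hr (halfVec₃ 0 0 k) = 0 ∧
    halfE₁ hq hr (halfVec₃ 0 1 k) = q⁻¹ • halfVec₃ 0 1 k - halfVec₃ 1 0 k ∧
    halfE₁ hq hr (halfVec₃ 1 0 k) = q • halfVec₃ 1 0 k - halfVec₃ 0 1 k ∧
    halfE₁ hq hr (halfVec₃ 1 1 k) = 0 := by
  have hr0 := sq_root_ne_zero hq hr
  have hs : (q - q⁻¹) ^ 2 ≠ 0 := pow_ne_zero _ (AWBar.sub_inv_ne_zero hq h2)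
  refine ⟨?_, ?_, ?_, ?_⟩
  all_goals rw [halfE₁, LinearMap.smul_apply, inv_smul_eq_iff₀ hs, halfC₁₂_eq]
  all_goals simp only [comul₁₂_E, comul₁₂_F, comul₁₂_qH, comul₁₂_qHinv, halfVec₃, spinRep₃_tmul,
    qH_halfVec_zero, qH_halfVec_one, E_halfVec_zero, E_halfVec_one hq hr h2, F_halfVec_zero,
    F_halfVec_one, qHinv_halfVec_zero, qHinv_halfVec_one, LinearMap.add_apply, LinearMap.sub_apply,
    LinearMap.smul_apply, Module.End.mul_apply, pow_two (spinRep₃ _ _ _ _ _ _), map_add, map_one,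
    Module.End.one_apply, map_smul, map_zero, ← TensorProduct.smul_tmul', TensorProduct.tmul_smul,
    TensorProduct.zero_tmul, TensorProduct.tmul_zero, smul_zero, add_zero, zero_add]
  all_goals subst hr
  all_goals simp only [chi]
  all_goals match_scalars
  all_goals field_simp
  all_goals ring

theorem halfE₂_halfVec₃ (i : Fin 2) (h2 : q ^ 2 ≠ 1) :
    halfE₂ hq hr (halfVec₃ i 0 0) = 0 ∧
    halfE₂ hq hr (halfVec₃ i 0 1) = q⁻¹ • halfVec₃ i 0 1 - halfVec₃ i 1 0 ∧
    halfE₂ hq hr (halfVec₃ i 1 0) = q • halfVec₃ i 1 0 - halfVec₃ i 0 1 ∧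
    halfE₂ hq hr (halfVec₃ i 1 1) = 0 := by
  have hr0 := sq_root_ne_zero hq hr
  have hs : (q - q⁻¹) ^ 2 ≠ 0 := pow_ne_zero _ (AWBar.sub_inv_ne_zero hq h2)
  refine ⟨?_, ?_, ?_, ?_⟩
  all_goals rw [halfE₂, LinearMap.smul_apply, inv_smul_eq_iff₀ hs, halfC₂₃_eq]
  all_goals simp only [comul₂₃_E, comul₂₃_F, comul₂₃_qH, comul₂₃_qHinv, halfVec₃, spinRep₃_tmul,
    qH_halfVec_zero, qH_halfVec_one, E_halfVec_zero, E_halfVec_one hq hr h2, F_halfVec_zero,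
    F_halfVec_one, qHinv_halfVec_zero, qHinv_halfVec_one, LinearMap.add_apply, LinearMap.sub_apply,
    LinearMap.smul_apply, Module.End.mul_apply, pow_two (spinRep₃ _ _ _ _ _ _), map_add, map_one,
    Module.End.one_apply, map_smul, map_zero, ← TensorProduct.smul_tmul', TensorProduct.tmul_smul,
    TensorProduct.zero_tmul, TensorProduct.tmul_zero, smul_zero, add_zero, zero_add]
  all_goals subst hr
  all_goals simp only [chi]
  all_goals match_scalars
  all_goals field_simp
  all_goals ring

theorem comul₂_E_halfVec₃ (h2 : q ^ 2 ≠ 1) :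
    ρ (Uq.comul₂ hq (Uq.E q)) (halfVec₃ 0 0 0) = 0 ∧
    ρ (Uq.comul₂ hq (Uq.E q)) (halfVec₃ 1 0 0) = q⁻¹ • halfVec₃ 0 0 0 ∧
    ρ (Uq.comul₂ hq (Uq.E q)) (halfVec₃ 0 1 0) = halfVec₃ 0 0 0 ∧
    ρ (Uq.comul₂ hq (Uq.E q)) (halfVec₃ 0 0 1) = q • halfVec₃ 0 0 0 ∧
    ρ (Uq.comul₂ hq (Uq.E q)) (halfVec₃ 1 1 0) = halfVec₃ 0 1 0 + q⁻¹ • halfVec₃ 1 0 0 ∧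
    ρ (Uq.comul₂ hq (Uq.E q)) (halfVec₃ 1 0 1) = halfVec₃ 0 0 1 + halfVec₃ 1 0 0 ∧
    ρ (Uq.comul₂ hq (Uq.E q)) (halfVec₃ 0 1 1) = q • halfVec₃ 0 0 1 + halfVec₃ 0 1 0 ∧
    ρ (Uq.comul₂ hq (Uq.E q)) (halfVec₃ 1 1 1) = q • halfVec₃ 0 1 1 + halfVec₃ 1 0 1 +
      q⁻¹ • halfVec₃ 1 1 0 := by
  have hr0 := sq_root_ne_zero hq hr
  refine ⟨?_, ?_, ?_, ?_, ?_, ?_, ?_, ?_⟩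
  all_goals simp only [comul₂_E, halfVec₃, spinRep₃_tmul,
    qH_halfVec_zero, qH_halfVec_one, E_halfVec_zero, E_halfVec_one hq hr h2, F_halfVec_zero,
    F_halfVec_one, qHinv_halfVec_zero, qHinv_halfVec_one, LinearMap.add_apply, LinearMap.sub_apply,
    LinearMap.smul_apply, Module.End.mul_apply, pow_two (spinRep₃ _ _ _ _ _ _), map_add, map_one,
    Module.End.one_apply, map_smul, map_zero, ← TensorProduct.smul_tmul', TensorProduct.tmul_smul,
    TensorProduct.zero_tmul, TensorProduct.tmul_zero, smul_zero, add_zero, zero_add]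
  all_goals subst hr
  all_goals match_scalars
  all_goals field_simp

theorem comul₂_F_halfVec₃ :
    ρ (Uq.comul₂ hq (Uq.F q)) (halfVec₃ 0 0 0) = q⁻¹ • halfVec₃ 1 0 0 + halfVec₃ 0 1 0 +
      q • halfVec₃ 0 0 1 ∧
    ρ (Uq.comul₂ hq (Uq.F q)) (halfVec₃ 1 0 0) = q⁻¹ • halfVec₃ 1 1 0 + halfVec₃ 1 0 1 ∧
    ρ (Uq.comul₂ hq (Uq.F q)) (halfVec₃ 0 1 0) = halfVec₃ 1 1 0 + halfVec₃ 0 1 1 ∧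
    ρ (Uq.comul₂ hq (Uq.F q)) (halfVec₃ 0 0 1) = halfVec₃ 1 0 1 + q • halfVec₃ 0 1 1 ∧
    ρ (Uq.comul₂ hq (Uq.F q)) (halfVec₃ 1 1 0) = q⁻¹ • halfVec₃ 1 1 1 ∧
    ρ (Uq.comul₂ hq (Uq.F q)) (halfVec₃ 1 0 1) = halfVec₃ 1 1 1 ∧
    ρ (Uq.comul₂ hq (Uq.F q)) (halfVec₃ 0 1 1) = q • halfVec₃ 1 1 1 ∧
    ρ (Uq.comul₂ hq (Uq.F q)) (halfVec₃ 1 1 1) = 0 := by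
  have hr0 := sq_root_ne_zero hq hr
  refine ⟨?_, ?_, ?_, ?_, ?_, ?_, ?_, ?_⟩
  all_goals simp only [comul₂_F, halfVec₃, spinRep₃_tmul,
    qH_halfVec_zero, qH_halfVec_one, E_halfVec_zero, F_halfVec_zero,
    F_halfVec_one, qHinv_halfVec_zero, qHinv_halfVec_one, LinearMap.add_apply, LinearMap.sub_apply,
    LinearMap.smul_apply, Module.End.mul_apply, pow_two (spinRep₃ _ _ _ _ _ _), map_add, map_one,
    Module.End.one_apply, map_smul, map_zero, ← TensorProduct.smul_tmul', TensorProduct.tmul_smul,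
    TensorProduct.zero_tmul, TensorProduct.tmul_zero, smul_zero, add_zero, zero_add]
  all_goals subst hr
  all_goals match_scalars
  all_goals field_simp

theorem comul₂_qH_halfVec₃ :
    ρ (Uq.comul₂ hq (Uq.qH q)) (halfVec₃ 0 0 0) = r ^ 3 • halfVec₃ 0 0 0 ∧
    ρ (Uq.comul₂ hq (Uq.qH q)) (halfVec₃ 0 0 1) = r • halfVec₃ 0 0 1 ∧
    ρ (Uq.comul₂ hq (Uq.qH q)) (halfVec₃ 0 1 0) = r • halfVec₃ 0 1 0 ∧
    ρ (Uq.comul₂ hq (Uq.qH q)) (halfVec₃ 0 1 1) = r⁻¹ • halfVec₃ 0 1 1 ∧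
    ρ (Uq.comul₂ hq (Uq.qH q)) (halfVec₃ 1 0 0) = r • halfVec₃ 1 0 0 ∧
    ρ (Uq.comul₂ hq (Uq.qH q)) (halfVec₃ 1 0 1) = r⁻¹ • halfVec₃ 1 0 1 ∧
    ρ (Uq.comul₂ hq (Uq.qH q)) (halfVec₃ 1 1 0) = r⁻¹ • halfVec₃ 1 1 0 ∧
    ρ (Uq.comul₂ hq (Uq.qH q)) (halfVec₃ 1 1 1) = (r ^ 3)⁻¹ • halfVec₃ 1 1 1 := by
  have hr0 := sq_root_ne_zero hq hr
  refine ⟨?_, ?_, ?_, ?_, ?_, ?_, ?_, ?_⟩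
  all_goals simp only [comul₂_qH, halfVec₃, spinRep₃_tmul,
    qH_halfVec_zero, qH_halfVec_one, E_halfVec_zero, F_halfVec_zero,
    F_halfVec_one, qHinv_halfVec_zero, qHinv_halfVec_one, LinearMap.add_apply, LinearMap.sub_apply,
    LinearMap.smul_apply, Module.End.mul_apply, pow_two (spinRep₃ _ _ _ _ _ _), map_add, map_one,
    Module.End.one_apply, map_smul, map_zero, ← TensorProduct.smul_tmul', TensorProduct.tmul_smul,
    TensorProduct.zero_tmul, TensorProduct.tmul_zero, smul_zero, add_zero, zero_add]
  all_goals subst hr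
  all_goals match_scalars
  all_goals field_simp

theorem comul₂_qHinv_halfVec₃ :
    ρ (Uq.comul₂ hq (Uq.qHinv q)) (halfVec₃ 0 0 0) = (r ^ 3)⁻¹ • halfVec₃ 0 0 0 ∧
    ρ (Uq.comul₂ hq (Uq.qHinv q)) (halfVec₃ 0 0 1) = r⁻¹ • halfVec₃ 0 0 1 ∧
    ρ (Uq.comul₂ hq (Uq.qHinv q)) (halfVec₃ 0 1 0) = r⁻¹ • halfVec₃ 0 1 0 ∧
    ρ (Uq.comul₂ hq (Uq.qHinv q)) (halfVec₃ 0 1 1) = r • halfVec₃ 0 1 1 ∧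
    ρ (Uq.comul₂ hq (Uq.qHinv q)) (halfVec₃ 1 0 0) = r⁻¹ • halfVec₃ 1 0 0 ∧
    ρ (Uq.comul₂ hq (Uq.qHinv q)) (halfVec₃ 1 0 1) = r • halfVec₃ 1 0 1 ∧
    ρ (Uq.comul₂ hq (Uq.qHinv q)) (halfVec₃ 1 1 0) = r • halfVec₃ 1 1 0 ∧
    ρ (Uq.comul₂ hq (Uq.qHinv q)) (halfVec₃ 1 1 1) = r ^ 3 • halfVec₃ 1 1 1 := by
  have hr0 := sq_root_ne_zero hq hr
  refine ⟨?_, ?_, ?_, ?_, ?_, ?_, ?_, ?_⟩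
  all_goals simp only [comul₂_qHinv, halfVec₃, spinRep₃_tmul,
    qH_halfVec_zero, qH_halfVec_one, E_halfVec_zero, F_halfVec_zero,
    F_halfVec_one, qHinv_halfVec_zero, qHinv_halfVec_one, LinearMap.add_apply, LinearMap.sub_apply,
    LinearMap.smul_apply, Module.End.mul_apply, pow_two (spinRep₃ _ _ _ _ _ _), map_add, map_one,
    Module.End.one_apply, map_smul, map_zero, ← TensorProduct.smul_tmul', TensorProduct.tmul_smul,
    TensorProduct.zero_tmul, TensorProduct.tmul_zero, smul_zero, add_zero, zero_add]
  all_goals subst hr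
  all_goals match_scalars
  all_goals field_simp

end Action

section HalfAction

variable {q r : ℂ} (hq : q ≠ 0) (hr : r ^ 2 = q)

local notation "ρ" => spinRep₃ hq hr 1 1 1

theorem end₃_ext_cases {m m' : End₃ 1 1 1}
    (h : (m (halfVec₃ 0 0 0) = m' (halfVec₃ 0 0 0) ∧ m (halfVec₃ 0 0 1) = m' (halfVec₃ 0 0 1)) ∧
      (m (halfVec₃ 0 1 0) = m' (halfVec₃ 0 1 0) ∧ m (halfVec₃ 0 1 1) = m' (halfVec₃ 0 1 1)) ∧
      (m (halfVec₃ 1 0 0) = m' (halfVec₃ 1 0 0) ∧ m (halfVec₃ 1 0 1) = m' (halfVec₃ 1 0 1)) ∧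
      (m (halfVec₃ 1 1 0) = m' (halfVec₃ 1 1 0) ∧ m (halfVec₃ 1 1 1) = m' (halfVec₃ 1 1 1))) :
    m = m' := by
  apply end₃_ext
  simp only [Fin.forall_fin_two]
  tauto

include hq in
theorem isTL_halfE (h2 : q ^ 2 ≠ 1) : IsTL q (halfE₁ hq hr) (halfE₂ hq hr) := by
  have h₁ := fun k => halfE₁_halfVec₃ hq hr k h2
  have h₂ := fun k => halfE₂_halfVec₃ hq hr k h2
  constructor
  all_goals
    apply end₃_ext_cases
    simp only [Module.End.mul_apply, LinearMap.smul_apply, h₁, h₂, map_sub, map_smul, map_zero,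
      smul_zero, sub_zero, zero_sub, map_neg, true_and, and_true]
    repeat' apply And.intro
  all_goals match_scalars
  all_goals field_simp
  all_goals ring

theorem halfC₁₂_eq_tlAW (h2 : q ^ 2 ≠ 1) :
    halfC₁₂ hq hr = tlAW q (halfE₁ hq hr) (halfE₂ hq hr) 1 0 0 0 := by
  have hs : (q - q⁻¹) ^ 2 ≠ 0 := pow_ne_zero _ (AWBar.sub_inv_ne_zero hq h2)
  rw [tlAW_eq]
  simp only [tlWord, zero_smul, one_smul, zero_add, add_zero]
  rw [halfE₁, smul_inv_smul₀ hs]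
  exact (sub_sub_cancel (G := End₃ 1 1 1) _ _).symm

theorem halfC₂₃_eq_tlAW (h2 : q ^ 2 ≠ 1) :
    halfC₂₃ hq hr = tlAW q (halfE₁ hq hr) (halfE₂ hq hr) 0 1 0 0 := by
  have hs : (q - q⁻¹) ^ 2 ≠ 0 := pow_ne_zero _ (AWBar.sub_inv_ne_zero hq h2)
  rw [tlAW_eq]
  simp only [tlWord, zero_smul, one_smul, zero_add, add_zero]
  rw [halfE₂, smul_inv_smul₀ hs]
  exact (sub_sub_cancel (G := End₃ 1 1 1) _ _).symm

theorem halfC₁₂₃_eq_tlK (h2 : q ^ 2 ≠ 1) :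
    halfC₁₂₃ hq hr = tlK q (halfE₁ hq hr) (halfE₂ hq hr) := by
  have h₁ := fun k => halfE₁_halfVec₃ hq hr k h2
  have h₂ := fun k => halfE₂_halfVec₃ hq hr k h2
  have hr0 := sq_root_ne_zero hq hr
  apply end₃_ext_cases
  simp only [halfC₁₂₃_eq, tlK, tlWord, Module.End.mul_apply, LinearMap.smul_apply,
    LinearMap.add_apply, Module.End.one_apply, h₁, h₂, map_sub, map_smul, map_zero, map_add,
    pow_two (ρ _), smul_zero, sub_zero, zero_sub, comul₂_E_halfVec₃ hq hr h2,
    comul₂_F_halfVec₃ hq hr, comul₂_qH_halfVec₃ hq hr, comul₂_qHinv_halfVec₃ hq hr]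
  clear h₁ h₂
  refine ⟨⟨?_, ?_⟩, ⟨?_, ?_⟩, ⟨?_, ?_⟩, ⟨?_, ?_⟩⟩
  all_goals subst hr
  all_goals simp only [chi]
  all_goals match_scalars
  all_goals field_simp
  all_goals ring

theorem commute_halfE₁ (h2 : q ^ 2 ≠ 1) (x : Uq q) :
    Commute (halfE₁ hq hr) (ρ (Uq.comul₂ hq x)) := by
  have h₁ := fun k => halfE₁_halfVec₃ hq hr k h2
  refine Uq.commute_of_gen (R := End₃ 1 1 1) ((ρ).comp (Uq.comul₂ hq)) ?_ ?_ ?_ ?_ x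
  all_goals
    apply end₃_ext_cases
    simp only [AlgHom.comp_apply, Module.End.mul_apply, h₁, map_sub, map_smul, map_zero, map_add,
      smul_zero, add_zero, zero_add, true_and, and_true, comul₂_E_halfVec₃ hq hr h2,
      comul₂_F_halfVec₃ hq hr, comul₂_qH_halfVec₃ hq hr, comul₂_qHinv_halfVec₃ hq hr]
    clear h₁
    repeat' apply And.intro
  all_goals match_scalars
  all_goals field_simp
  all_goals ring

theorem commute_halfE₂ (h2 : q ^ 2 ≠ 1) (x : Uq q) :
    Commute (halfE₂ hq hr) (ρ (Uq.comul₂ hq x)) := by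
  have h₁ := fun k => halfE₂_halfVec₃ hq hr k h2
  refine Uq.commute_of_gen (R := End₃ 1 1 1) ((ρ).comp (Uq.comul₂ hq)) ?_ ?_ ?_ ?_ x
  all_goals
    apply end₃_ext_cases
    simp only [AlgHom.comp_apply, Module.End.mul_apply, h₁, map_sub, map_smul, map_zero, map_add,
      smul_zero, add_zero, zero_add, true_and, and_true, comul₂_E_halfVec₃ hq hr h2,
      comul₂_F_halfVec₃ hq hr, comul₂_qH_halfVec₃ hq hr, comul₂_qHinv_halfVec₃ hq hr]
    clear h₁
    repeat' apply And.intro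
  all_goals match_scalars
  all_goals field_simp
  all_goals ring

/-- The coordinate functionals dual to `halfVec₃`. -/
noncomputable def halfCoord (i j k : Fin 2) :
    SpinSpace 1 ⊗[ℂ] (SpinSpace 1 ⊗[ℂ] SpinSpace 1) →ₗ[ℂ] ℂ :=
  halfBasis.coord (i, j, k)

theorem halfCoord_halfVec₃ (i j k i' j' k' : Fin 2) :
    halfCoord i j k (halfVec₃ i' j' k') = if (i', j', k') = (i, j, k) then 1 else 0 := by
  rw [halfCoord, ← halfBasis_apply, Module.Basis.coord_apply, Module.Basis.repr_self,
    Finsupp.single_apply]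

theorem sum_halfCoord (w : SpinSpace 1 ⊗[ℂ] (SpinSpace 1 ⊗[ℂ] SpinSpace 1)) :
    w = halfCoord 0 0 0 w • halfVec₃ 0 0 0 + halfCoord 0 0 1 w • halfVec₃ 0 0 1 +
      halfCoord 0 1 0 w • halfVec₃ 0 1 0 + halfCoord 0 1 1 w • halfVec₃ 0 1 1 +
      halfCoord 1 0 0 w • halfVec₃ 1 0 0 + halfCoord 1 0 1 w • halfVec₃ 1 0 1 +
      halfCoord 1 1 0 w • halfVec₃ 1 1 0 + halfCoord 1 1 1 w • halfVec₃ 1 1 1 := by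
  conv_lhs => rw [← halfBasis.sum_repr w]
  simp only [Fintype.sum_prod_type, Fin.sum_univ_two, halfBasis_apply, halfCoord,
    Module.Basis.coord_apply]
  abel

/-- A vector of maximal weight is a multiple of the highest weight vector. -/
theorem eq_smul_of_weight_three (h1 : q ≠ 1) (h2 : q ^ 2 ≠ 1) (h3 : q ^ 3 ≠ 1)
    {w : SpinSpace 1 ⊗[ℂ] (SpinSpace 1 ⊗[ℂ] SpinSpace 1)}
    (hw : ρ (Uq.comul₂ hq (Uq.qH q)) w = r ^ 3 • w) :
    w = halfCoord 0 0 0 w • halfVec₃ 0 0 0 := by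
  have hr0 := sq_root_ne_zero hq hr
  have hr1 : r ≠ r ^ 3 := by
    intro h
    apply h1
    rw [← hr]
    exact mul_left_cancel₀ hr0 (by linear_combination -h)
  have hr2 : r⁻¹ ≠ r ^ 3 := by
    intro h
    apply h2
    rw [← hr]
    field_simp at h
    linear_combination -h
  have hr3 : (r ^ 3)⁻¹ ≠ r ^ 3 := by
    intro h
    apply h3
    rw [← hr]
    field_simp at h
    linear_combination -h
  have hc (i j k : Fin 2) := congrArg (halfCoord i j k) hw
  rw [sum_halfCoord w] at hc
  simp only [map_add, map_smul, comul₂_qH_halfVec₃ hq hr, halfCoord_halfVec₃] at hc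
  have c1 := hc 0 0 1
  have c2 := hc 0 1 0
  have c3 := hc 0 1 1
  have c4 := hc 1 0 0
  have c5 := hc 1 0 1
  have c6 := hc 1 1 0
  have c7 := hc 1 1 1
  simp [mul_comm (halfCoord _ _ _ w), hr1, hr2, hr3] at c1 c2 c3 c4 c5 c6 c7
  conv_lhs => rw [sum_halfCoord w]
  simp [c1, c2, c3, c4, c5, c6, c7]

/-- A vector of weight one below the maximum is a combination of the three basis vectors of that
weight. -/
theorem eq_sum_of_weight_one (h1 : q ≠ 1) (h2 : q ^ 2 ≠ 1)
    {w : SpinSpace 1 ⊗[ℂ] (SpinSpace 1 ⊗[ℂ] SpinSpace 1)}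
    (hw : ρ (Uq.comul₂ hq (Uq.qH q)) w = r • w) :
    w = halfCoord 1 0 0 w • halfVec₃ 1 0 0 + halfCoord 0 1 0 w • halfVec₃ 0 1 0 +
      halfCoord 0 0 1 w • halfVec₃ 0 0 1 := by
  have hr0 := sq_root_ne_zero hq hr
  have hr1 : r ^ 3 ≠ r := by
    intro h
    apply h1
    rw [← hr]
    exact mul_left_cancel₀ hr0 (by linear_combination h)
  have hr2 : r⁻¹ ≠ r := by
    intro h
    apply h1
    rw [← hr]
    field_simp at h
    linear_combination -h
  have hr3 : (r ^ 3)⁻¹ ≠ r := by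
    intro h
    apply h2
    rw [← hr]
    field_simp at h
    linear_combination -h
  have hc (i j k : Fin 2) := congrArg (halfCoord i j k) hw
  rw [sum_halfCoord w] at hc
  simp only [map_add, map_smul, comul₂_qH_halfVec₃ hq hr, halfCoord_halfVec₃] at hc
  have c1 := hc 0 0 0
  have c3 := hc 0 1 1
  have c5 := hc 1 0 1
  have c6 := hc 1 1 0
  have c7 := hc 1 1 1
  simp [mul_comm (halfCoord _ _ _ w), hr1, hr2, hr3] at c1 c3 c5 c6 c7
  conv_lhs => rw [sum_halfCoord w]
  simp [c1, c3, c5, c6, c7]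
  abel

/-- The five coordinates of an element of the Temperley–Lieb algebra. -/
theorem halfCoord_tlWord (h2 : q ^ 2 ≠ 1) (a b c d g : ℂ) :
    halfCoord 1 0 0 (tlWord (halfE₁ hq hr) (halfE₂ hq hr) a b c d g (halfVec₃ 1 0 0)) =
      a + q * b ∧
    halfCoord 0 0 1 (tlWord (halfE₁ hq hr) (halfE₂ hq hr) a b c d g (halfVec₃ 1 0 0)) = g ∧
    halfCoord 1 0 0 (tlWord (halfE₁ hq hr) (halfE₂ hq hr) a b c d g (halfVec₃ 0 1 0)) =
      -b - q * d ∧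
    halfCoord 1 0 0 (tlWord (halfE₁ hq hr) (halfE₂ hq hr) a b c d g (halfVec₃ 0 0 1)) = d ∧
    halfCoord 0 1 0 (tlWord (halfE₁ hq hr) (halfE₂ hq hr) a b c d g (halfVec₃ 0 0 1)) =
      -c - q⁻¹ * d := by
  have h₁ := fun k => halfE₁_halfVec₃ hq hr k h2
  have h₂ := fun k => halfE₂_halfVec₃ hq hr k h2
  simp only [tlWord, Module.End.mul_apply, LinearMap.smul_apply, LinearMap.add_apply,
    Module.End.one_apply, h₁, h₂, map_sub, map_smul, map_zero, map_add, halfCoord_halfVec₃]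
  refine ⟨?_, ?_, ?_, ?_, ?_⟩ <;> simp <;> ring

theorem eq_zero_of_tlWord_eq_zero (h2 : q ^ 2 ≠ 1) {a b c d g : ℂ}
    (h : tlWord (halfE₁ hq hr) (halfE₂ hq hr) a b c d g = 0) :
    a = 0 ∧ b = 0 ∧ c = 0 ∧ d = 0 ∧ g = 0 := by
  obtain ⟨h1, h2, h3, h4, h5⟩ := halfCoord_tlWord hq hr h2 a b c d g
  simp only [h, LinearMap.zero_apply, map_zero] at h1 h2 h3 h4 h5
  obtain rfl : d = 0 := h4.symm
  obtain rfl : g = 0 := h2.symm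
  obtain rfl : b = 0 := by linear_combination h3
  obtain rfl : c = 0 := by linear_combination h5
  exact ⟨by linear_combination -h1, rfl, rfl, rfl, rfl⟩

/-- An endomorphism commuting with `F` which kills the two highest weight spaces vanishes. -/
theorem eq_zero_of_commute_F (h4 : q ^ 4 ≠ 1) {m : End₃ 1 1 1}
    (hF : Commute m (ρ (Uq.comul₂ hq (Uq.F q)))) (h000 : m (halfVec₃ 0 0 0) = 0)
    (h100 : m (halfVec₃ 1 0 0) = 0) (h010 : m (halfVec₃ 0 1 0) = 0)
    (h001 : m (halfVec₃ 0 0 1) = 0) : m = 0 := by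
  have hδ := AWBar.add_inv_ne_zero hq h4
  have hm (v) : m (ρ (Uq.comul₂ hq (Uq.F q)) v) = ρ (Uq.comul₂ hq (Uq.F q)) (m v) :=
    LinearMap.congr_fun hF.eq v
  have e1 := hm (halfVec₃ 1 0 0)
  have e2 := hm (halfVec₃ 0 1 0)
  have e3 := hm (halfVec₃ 0 0 1)
  simp only [comul₂_F_halfVec₃ hq hr, h100, h010, h001, map_zero, map_add, map_smul] at e1 e2 e3
  have h110 : m (halfVec₃ 1 1 0) = 0 := by
    rw [← smul_eq_zero_iff_right hδ]
    calc _ = (q⁻¹ • m (halfVec₃ 1 1 0) + m (halfVec₃ 1 0 1)) -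
          (m (halfVec₃ 1 0 1) + q • m (halfVec₃ 0 1 1)) +
          q • (m (halfVec₃ 1 1 0) + m (halfVec₃ 0 1 1)) := by module
      _ = 0 := by rw [e1, e2, e3]; simp
  rw [h110, smul_zero, zero_add] at e1
  rw [h110, zero_add] at e2
  have e4 := hm (halfVec₃ 1 0 1)
  simp only [comul₂_F_halfVec₃ hq hr, e1, map_zero] at e4
  apply end₃_ext_cases
  simp [*]

/-- A Temperley–Lieb coordinate criterion for the vanishing of an element of the centralizer. -/
theorem eq_zero_of_halfCoord (hroot : ∀ n : ℕ, 0 < n → q ^ n ≠ 1) {m : End₃ 1 1 1}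
    (hm : ∀ x, Commute m (ρ (Uq.comul₂ hq x)))
    (k1 : halfCoord 1 0 0 (m (halfVec₃ 1 0 0)) = 0)
    (k2 : halfCoord 0 0 1 (m (halfVec₃ 1 0 0)) = 0)
    (k3 : halfCoord 1 0 0 (m (halfVec₃ 0 1 0)) = 0)
    (k4 : halfCoord 1 0 0 (m (halfVec₃ 0 0 1)) = 0)
    (k5 : halfCoord 0 1 0 (m (halfVec₃ 0 0 1)) = 0) : m = 0 := by
  have h1 : q ≠ 1 := by simpa using hroot 1
  have h2 := hroot 2 (by norm_num)
  have hc (x v) : m (ρ (Uq.comul₂ hq x) v) = ρ (Uq.comul₂ hq x) (m v) :=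
    LinearMap.congr_fun (hm x).eq v
  have w000 := hc (Uq.qH q) (halfVec₃ 0 0 0)
  have w100 := hc (Uq.qH q) (halfVec₃ 1 0 0)
  have w010 := hc (Uq.qH q) (halfVec₃ 0 1 0)
  have w001 := hc (Uq.qH q) (halfVec₃ 0 0 1)
  have f000 := hc (Uq.F q) (halfVec₃ 0 0 0)
  have e100 := hc (Uq.E q) (halfVec₃ 1 0 0)
  have e001 := hc (Uq.E q) (halfVec₃ 0 0 1)
  simp only [comul₂_F_halfVec₃ hq hr, comul₂_E_halfVec₃ hq hr h2, comul₂_qH_halfVec₃ hq hr,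
    map_add, map_smul] at w000 w100 w010 w001 f000 e100 e001
  have m000 := eq_smul_of_weight_three hq hr h1 h2 (hroot 3 (by norm_num)) w000.symm
  have m100 := eq_sum_of_weight_one hq hr h1 h2 w100.symm
  have m010 := eq_sum_of_weight_one hq hr h1 h2 w010.symm
  have m001 := eq_sum_of_weight_one hq hr h1 h2 w001.symm
  rw [k1, k2, zero_smul, zero_smul, zero_add, add_zero] at m100
  rw [k3, zero_smul, zero_add] at m010
  rw [k4, k5, zero_smul, zero_smul, zero_add, zero_add] at m001
  generalize halfCoord 0 0 0 (m (halfVec₃ 0 0 0)) = l at m000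
  generalize halfCoord 0 1 0 (m (halfVec₃ 1 0 0)) = y1 at m100
  generalize halfCoord 0 1 0 (m (halfVec₃ 0 1 0)) = y2 at m010
  generalize halfCoord 0 0 1 (m (halfVec₃ 0 1 0)) = z2 at m010
  generalize halfCoord 0 0 1 (m (halfVec₃ 0 0 1)) = z3 at m001
  rw [m000, m100, m010, m001] at f000
  rw [m000, m100] at e100
  rw [m000, m001] at e001
  have a1 := congrArg (halfCoord 1 0 0) f000
  have a2 := congrArg (halfCoord 0 1 0) f000
  have a3 := congrArg (halfCoord 0 0 1) f000
  have a4 := congrArg (halfCoord 0 0 0) e100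
  have a5 := congrArg (halfCoord 0 0 0) e001
  simp only [comul₂_F_halfVec₃ hq hr, comul₂_E_halfVec₃ hq hr h2, map_add, map_smul,
    halfCoord_halfVec₃] at a1 a2 a3 a4 a5
  simp [hq] at a1
  subst a1
  simp at a4
  subst a4
  simp [hq] at a5
  subst a5
  simp at a2
  subst a2
  simp at a3
  subst a3
  apply eq_zero_of_commute_F hq hr (hroot 4 (by norm_num)) (hm _)
  · simp [m000]
  · simp [m100]
  · simp [m010]
  · simp [m001]

/-- The centralizer is spanned by the words in the Temperley–Lieb generators. -/
theorem exists_eq_tlWord_of_commute (hroot : ∀ n : ℕ, 0 < n → q ^ n ≠ 1) {m : End₃ 1 1 1}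
    (hm : ∀ x, Commute m (ρ (Uq.comul₂ hq x))) :
    ∃ a b c d g, m = tlWord (halfE₁ hq hr) (halfE₂ hq hr) a b c d g := by
  have h2 := hroot 2 (by norm_num)
  set d := halfCoord 1 0 0 (m (halfVec₃ 0 0 1)) with hd
  set b := -halfCoord 1 0 0 (m (halfVec₃ 0 1 0)) - q * d with hb
  set c := -halfCoord 0 1 0 (m (halfVec₃ 0 0 1)) - q⁻¹ * d with hc
  set g := halfCoord 0 0 1 (m (halfVec₃ 1 0 0)) with hg
  set a := halfCoord 1 0 0 (m (halfVec₃ 1 0 0)) - q * b with ha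
  obtain ⟨k1, k2, k3, k4, k5⟩ := halfCoord_tlWord hq hr h2 a b c d g
  refine ⟨a, b, c, d, g, sub_eq_zero.1 (eq_zero_of_halfCoord hq hr hroot (fun x => ?_) ?_ ?_ ?_ ?_
    ?_)⟩
  · have h₁ := commute_halfE₁ hq hr h2 x
    have h₂ := commute_halfE₂ hq hr h2 x
    exact Commute.sub_left (R := End₃ 1 1 1) (hm x) (commute_tlWord h₁ h₂ _ _ _ _ _)
  · rw [LinearMap.sub_apply, map_sub, k1, ha]; ring
  · rw [LinearMap.sub_apply, map_sub, k2, hg]; ring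
  · rw [LinearMap.sub_apply, map_sub, k3, hb]; ring
  · rw [LinearMap.sub_apply, map_sub, k4, hd]; ring
  · rw [LinearMap.sub_apply, map_sub, k5, hc]; ring

end HalfAction

theorem mainTheorem2 (q r : ℂ) (hq : q ≠ 0) (hroot : ∀ n : ℕ, 0 < n → q ^ n ≠ 1)
    (hr : r ^ 2 = q) :
    ∃! φ : AWBar q 1 1 1 ≃ₐ[ℂ] spinCentralizer hq hr 1 1 1,
      (φ (AWBar.mk q 1 1 1 (AW3.A q)) : End₃ 1 1 1) = spinRep₃ hq hr 1 1 1 (Uq.casimir₁₂ hq) ∧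
      (φ (AWBar.mk q 1 1 1 (AW3.B q)) : End₃ 1 1 1) = spinRep₃ hq hr 1 1 1 (Uq.casimir₂₃ hq) ∧
      (φ (AWBar.mk q 1 1 1 (AW3.K q)) : End₃ 1 1 1) = spinRep₃ hq hr 1 1 1 (Uq.casimir₁₂₃ hq) := by
  have h2 := hroot 2 (by norm_num)
  have hTL := isTL_halfE hq hr h2
  let ψ : AWBar q 1 1 1 →ₐ[ℂ] End₃ 1 1 1 := hTL.awBarHom hq hroot
  have hψA : ψ (AWBar.mk q 1 1 1 (AW3.A q)) = halfC₁₂ hq hr :=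
    (hTL.awBarHom_mk_gen hq hroot .A).trans (halfC₁₂_eq_tlAW hq hr h2).symm
  have hψB : ψ (AWBar.mk q 1 1 1 (AW3.B q)) = halfC₂₃ hq hr :=
    (hTL.awBarHom_mk_gen hq hroot .B).trans (halfC₂₃_eq_tlAW hq hr h2).symm
  have hψK : ψ (AWBar.mk q 1 1 1 (AW3.K q)) = halfC₁₂₃ hq hr :=
    (hTL.awBarHom_mk_gen hq hroot .K).trans (halfC₁₂₃_eq_tlK hq hr h2).symm
  have hψe : ψ (AWBar.e q) = halfE₁ hq hr := by
    simp only [AWBar.e, halfE₁, map_smul, map_sub, map_one, hψA]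
  have hψf : ψ (AWBar.f q) = halfE₂ hq hr := by
    simp only [AWBar.f, halfE₂, map_smul, map_sub, map_one, hψB]
  have hψ (a b c d g : ℂ) : ψ (tlWord (AWBar.e q) (AWBar.f q) a b c d g) =
      tlWord (halfE₁ hq hr) (halfE₂ hq hr) a b c d g := by
    rw [← hψe, ← hψf]
    exact map_tlWord (S := End₃ 1 1 1) ψ a b c d g
  have hmem (m : End₃ 1 1 1) : m ∈ spinCentralizer hq hr 1 1 1 ↔
      ∀ x, Commute m (spinRep₃ hq hr 1 1 1 (Uq.comul₂ hq x)) := by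
    simp only [spinCentralizer, Subalgebra.mem_centralizer_iff, Set.forall_mem_range]
    exact forall_congr' fun x => eq_comm
  have hrange (x) : ψ x ∈ spinCentralizer hq hr 1 1 1 := by
    obtain ⟨a, b, c, d, g, rfl⟩ := AWBar.exists_eq_tlWord hq hroot x
    rw [hψ, hmem]
    intro x
    have h₁ := commute_halfE₁ hq hr h2 x
    have h₂ := commute_halfE₂ hq hr h2 x
    exact commute_tlWord h₁ h₂ _ _ _ _ _
  have hbij : Function.Bijective (ψ.codRestrict _ hrange) := by
    constructor
    · refine (injective_iff_map_eq_zero _).2 fun x hx => ?_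
      obtain ⟨a, b, c, d, g, rfl⟩ := AWBar.exists_eq_tlWord hq hroot x
      have hx' : ψ (tlWord (AWBar.e q) (AWBar.f q) a b c d g) = 0 := congrArg Subtype.val hx
      rw [hψ] at hx'
      obtain ⟨rfl, rfl, rfl, rfl, rfl⟩ := eq_zero_of_tlWord_eq_zero hq hr h2 hx'
      simp [tlWord]
    · rintro ⟨m, hm⟩
      obtain ⟨a, b, c, d, g, rfl⟩ := exists_eq_tlWord_of_commute hq hr hroot ((hmem m).1 hm)
      exact ⟨_, Subtype.ext (hψ a b c d g)⟩
  refine ⟨AlgEquiv.ofBijective _ hbij, ⟨hψA, hψB, hψK⟩, ?_⟩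
  rintro φ ⟨hA, hB, hK⟩
  have h : (spinCentralizer hq hr 1 1 1).val.comp φ.toAlgHom = ψ :=
    AWBar.algHom_ext (R := End₃ 1 1 1) (hA.trans hψA.symm) (hB.trans hψB.symm) (hK.trans hψK.symm)
  exact AlgEquiv.ext fun x => Subtype.ext (DFunLike.congr_fun h x)
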